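/- Let $(P,\pi,M,S)$ be a smooth principal fibre bundle with compact structure group $S$ with Lie algebra $\mathfrak s$, and let $(G,\theta)$ be a Lie group of automorphisms of $P$, i.e. $\theta\colon G\times P\to P$ is a smooth left action with $\theta(g,p\cdot s)=\theta(g,p)\cdot s$ for all $g\in G$, $p\in P$, $s\in S$; it induces an action of $G$ on $M$ by $g\cdot\pi(p)=\pi(\theta(g,p))$. Let $\mathcal A$ be the set of smooth connections on $P$ ($\mathfrak s$-valued 1-forms $\omega$ with $R_s^*\omega=\mathrm{Ad}(s^{-1})\circ\omega$ for all $s\in S$ which map the fundamental vector field of each $X\in\mathfrak s$ to $X$), let $\phi(g,\omega)=\theta_{g^{-1}}^*\omega$ be the left action of $G$ on $\mathcal A$, and let $\mathcal A_G=\{\omega\in\mathcal A : \phi(g,\omega)=\omega\ \text{for all } g\in G\}$. Let $k\in\mathbb N_{\ge1}\cup\{\infty,\omega\}$ (with $M$ analytic if $k=\omega$, which means analytic), and let $\mathcal P$ be a set of $C^k$-paths (piecewise $C^k$-curves $\gamma\colon[a,b]\to M$, $a<b$). Assume that $\mathcal P$ is $G$-invariant: for $\gamma\in\mathcal P$ and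 $g\in G$ the curve $t\mapsto g\cdot\gamma(t)$ belongs to $\mathcal P$. Choose $\nu_m\in\pi^{-1}(m)$ for each $m\in M$ and let $h^\nu_\gamma(\omega)\in S$, for $\gamma\in\mathcal P$ and $\omega\in\mathcal A$, be determined by: the parallel transport of $\nu_{\gamma(a)}$ along $\gamma$ with respect to $\omega$ is $\nu_{\gamma(b)}\cdot h_\gamma^\nu(\omega)$. Let $B(X)$ denote the $C^*$-algebra of bounded complex-valued functions on a set $X$, and let $\mathrm{Cyl}\subseteq B(\mathcal A)$ be the uniform closure of the unital $*$-algebra generated by the functions $\rho_{ij}\circ h^\nu_\gamma$, where $\gamma\in\mathcal P$ and $\rho_{ij}$ are the entries of irreducible (finite-dimensional, continuous, complex) matrix representations $\rho$ of $S$. Let $\overline{\mathcal A}=\mathrm{Spec}(\mathrm{Cyl})$ be the space of non-zero multiplicative linear functionals with the weak-$*$ topology, and let $\iota_{\mathcal A}\colon\mathcal A\to\overline{\mathcal A}$, $\omega\mapsto[f\mapsto f(\omega)]$. Let $R\subseteq B(\mathcal A_G)$ be the closure of $\{f|_{\mathcal A_G} : f\in\mathrm{Cyl}\}$, $\overline{\mathcal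 A_G}=\mathrm{Spec}(R)$ (the quantized reduced space) and $\iota_{\mathcal A_G}\colon\mathcal A_G\to\overline{\mathcal A_G}$ the evaluation map. Then $\phi_g^*(f)=f\circ\phi_g$ maps $\mathrm{Cyl}$ into itself for all $g\in G$, and: 1. $\Phi\colon G\times\overline{\mathcal A}\to\overline{\mathcal A}$, $\Phi(g,\overline\omega)=\overline\omega\circ\phi_g^*$, is the unique left action such that $\Phi_g$ is continuous and $\Phi_g\circ\iota_{\mathcal A}=\iota_{\mathcal A}\circ\phi_g$ for all $g\in G$. 2. The set $\overline{\mathcal A}_G=\{\overline\omega\in\overline{\mathcal A} : \Phi(g,\overline\omega)=\overline\omega\ \text{for all } g\in G\}$ of invariant generalized connections is compact. 3. The map $j\colon\overline{\mathcal A_G}\to\overline{\mathcal A}$, $j(\chi)(f)=\chi(f|_{\mathcal A_G})$, satisfies $j\circ\iota_{\mathcal A_G}=\iota_{\mathcal A}|_{\mathcal A_G}$ and is a homeomorphism onto the closure of $\iota_{\mathcal A}(\mathcal A_G)$ in $\overline{\mathcal A}$, and this closure is contained in $\overline{\mathcal A}_G$. 4. $\Phi$ is continuous if and only if for each generator $f=\rho_{ij}\circ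 h^\nu_\gamma$ of $\mathrm{Cyl}$ the map $G\to\mathrm{Cyl}$, $g\mapsto f\circ\phi_g=f\circ\theta_{g^{-1}}^*$, is continuous. -/

import Mathlib

open Set Topology
open scoped Manifold ContDiff

noncomputable section

namespace GenConn

/-! ### Bounded functions and spectra

`B(X)`, the algebra of all bounded complex functions on a set `X`, is `X →ᵇ ℂ` for `X` with the
discrete topology; the spectrum of a commutative C*-algebra is `WeakDual.characterSpace ℂ A`
(non-zero multiplicative functionals, weak-* topology). -/

section Spectra

set_option linter.unusedSectionVars false

variable {X Y : Type*} [TopologicalSpace X] [TopologicalSpace Y]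
  [DiscreteTopology X] [DiscreteTopology Y]

/-- The pullback `f ↦ f ∘ u`, as a *-homomorphism `B(X) → B(Y)`, for a map `u : Y → X`. -/
def pullback (u : Y → X) :
    BoundedContinuousFunction X ℂ →⋆ₐ[ℂ] BoundedContinuousFunction Y ℂ where
  toFun f := f.compContinuous ⟨u, continuous_of_discreteTopology⟩
  map_one' := rfl
  map_mul' _ _ := rfl
  map_zero' := rfl
  map_add' _ _ := rfl
  commutes' _ := rfl
  map_star' _ := rfl

theorem pullback_apply (u : Y → X) (f : BoundedContinuousFunction X ℂ) (y : Y) :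
    pullback u f y = f (u y) := rfl

/-- The map `ι_X : X → Spec(A)`, `x ↦ (f ↦ f x)`, for a unital *-subalgebra `A` of `B(X)`. -/
def iota (A : StarSubalgebra ℂ (BoundedContinuousFunction X ℂ)) (x : X) :
    WeakDual.characterSpace ℂ A :=
  ⟨StrongDual.toWeakDual
      ((BoundedContinuousFunction.evalCLM ℂ x).comp A.toSubalgebra.toSubmodule.subtypeL), by
    constructor
    · intro h
      have h1 := congrArg (fun F : WeakDual ℂ A => F 1) h
      exact one_ne_zero (α := ℂ) h1
    · intro f g
      rfl⟩

theorem iota_apply (A : StarSubalgebra ℂ (BoundedContinuousFunction X ℂ)) (x : X) (f : A) :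
    iota A x f = (f : BoundedContinuousFunction X ℂ) x := rfl

/-- The restriction C*-algebra: the closure of `u^*(A)` in `B(Y)`. -/
def restrAlg (A : StarSubalgebra ℂ (BoundedContinuousFunction X ℂ)) (u : Y → X) :
    StarSubalgebra ℂ (BoundedContinuousFunction Y ℂ) :=
  (A.map (pullback u)).topologicalClosure

/-- The map `Spec(B) → Spec(A)`, `χ ↦ χ ∘ u^*`, for closed unital *-subalgebras `A` of `B(X)` and
`B` of `B(Y)` and a map `u : Y → X` with `u^*(A) ⊆ B`. -/
def specMap (A : StarSubalgebra ℂ (BoundedContinuousFunction X ℂ))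
    (B : StarSubalgebra ℂ (BoundedContinuousFunction Y ℂ))
    [CompleteSpace A] [CompleteSpace B] (u : Y → X) (h : ∀ f ∈ A, pullback u f ∈ B) :
    WeakDual.characterSpace ℂ B → WeakDual.characterSpace ℂ A :=
  WeakDual.CharacterSpace.compContinuousMap
    (((pullback u).comp A.subtype).codRestrict B fun f => h f f.2)

theorem specMap_apply (A : StarSubalgebra ℂ (BoundedContinuousFunction X ℂ))
    (B : StarSubalgebra ℂ (BoundedContinuousFunction Y ℂ))
    [CompleteSpace A] [CompleteSpace B] (u : Y → X) (h : ∀ f ∈ A, pullback u f ∈ B)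
    (χ : WeakDual.characterSpace ℂ B) (f : A) :
    specMap A B u h χ f = χ ⟨pullback u f, h f f.2⟩ := rfl

theorem pullback_mem_restrAlg (A : StarSubalgebra ℂ (BoundedContinuousFunction X ℂ)) (u : Y → X) :
    ∀ f ∈ A, pullback u f ∈ restrAlg A u := fun f hf =>
  StarSubalgebra.le_topologicalClosure _ ⟨f, hf, rfl⟩

instance (A : StarSubalgebra ℂ (BoundedContinuousFunction X ℂ)) (u : Y → X) :
    CompleteSpace (restrAlg A u) :=
  inferInstanceAs (CompleteSpace (StarSubalgebra.topologicalClosure _))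

end Spectra

/-! ### Curves and paths -/

section Curves

/-- A map from a compact interval `[a, b]`, `a < b`, to `M`. -/
@[ext]
structure Curve (M : Type*) where
  a : ℝ
  b : ℝ
  lt : a < b
  toFun : Icc a b → M

/-- The values of a curve, extended constantly outside of the interval. -/
def Curve.val {M : Type*} (γ : Curve M) : ℝ → M := IccExtend γ.lt.le γ.toFun

/-- The curve `t ↦ f (γ t)`. -/
def Curve.map {M N : Type*} (f : M → N) (γ : Curve M) : Curve N where
  a := γ.a
  b := γ.b
  lt := γ.lt
  toFun := f ∘ γ.toFun

variable {E H M : Type*} [NormedAddCommGroup E] [NormedSpace ℝ E] [TopologicalSpace H]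
  (I : ModelWithCorners ℝ E H) [TopologicalSpace M] [ChartedSpace H M]

/-- `γ` is of class `C^k` on `[c, d]`: it extends to a `C^k` map on a larger open interval. -/
def IsOfClassOn (k : ℕ∞ω) (γ : ℝ → M) (c d : ℝ) : Prop :=
  ∃ c' < c, ∃ d' > d, ∃ δ : ℝ → M,
    ContMDiffOn 𝓘(ℝ, ℝ) I k δ (Ioo c' d') ∧ EqOn γ δ (Icc c d)

/-- `C^k`-paths: there are `a = τ₀ < ⋯ < τₙ = b` such that each `γ|[τᵢ, τᵢ₊₁]` is of class `C^k`. -/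
def IsPath (k : ℕ∞ω) (γ : Curve M) : Prop :=
  ∃ (n : ℕ) (τ : Fin (n + 1) → ℝ), StrictMono τ ∧ τ 0 = γ.a ∧ τ (Fin.last n) = γ.b ∧
    ∀ i : Fin n, IsOfClassOn I k γ.val (τ i.castSucc) (τ i.succ)

end Curves

/-! ### Principal fibre bundles, connections, parallel transport -/

variable {EM HM M EP HP P ES HS S EG HG G : Type*}
  [NormedAddCommGroup EM] [NormedSpace ℝ EM] [TopologicalSpace HM]
  {IM : ModelWithCorners ℝ EM HM} [TopologicalSpace M] [ChartedSpace HM M]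
  [NormedAddCommGroup EP] [NormedSpace ℝ EP] [TopologicalSpace HP]
  {IP : ModelWithCorners ℝ EP HP} [TopologicalSpace P] [ChartedSpace HP P]
  [NormedAddCommGroup ES] [NormedSpace ℝ ES] [TopologicalSpace HS]
  {IS : ModelWithCorners ℝ ES HS} [TopologicalSpace S] [ChartedSpace HS S] [Group S]
  [NormedAddCommGroup EG] [NormedSpace ℝ EG] [TopologicalSpace HG]
  {IG : ModelWithCorners ℝ EG HG} [TopologicalSpace G] [ChartedSpace HG G] [Group G]

/-- The data and axioms of a smooth principal fibre bundle `(P, π, M, S)`: `act p s` is `p · s`. -/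
structure PrincipalBundle (IM : ModelWithCorners ℝ EM HM) (IP : ModelWithCorners ℝ EP HP)
    (IS : ModelWithCorners ℝ ES HS) (M P S : Type*)
    [TopologicalSpace M] [ChartedSpace HM M] [TopologicalSpace P] [ChartedSpace HP P]
    [TopologicalSpace S] [ChartedSpace HS S] [Group S] where
  proj : P → M
  act : P → S → P
  contMDiff_proj : ContMDiff IP IM ∞ proj
  surjective_proj : Function.Surjective proj
  contMDiff_act : ContMDiff (IP.prod IS) IP ∞ fun x : P × S => act x.1 x.2
  act_one : ∀ p, act p 1 = p
  act_mul : ∀ p s t, act p (s * t) = act (act p s) t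
  proj_act : ∀ p s, proj (act p s) = proj p
  existsUnique_act : ∀ p p', proj p = proj p' → ∃! s, p' = act p s
  locally_trivial : ∀ x : M, ∃ U : Set M, IsOpen U ∧ x ∈ U ∧
    ∃ e : OpenPartialHomeomorph P (M × S),
      e.source = proj ⁻¹' U ∧ e.target = U ×ˢ univ ∧
      ContMDiffOn IP (IM.prod IS) ∞ e e.source ∧
      ContMDiffOn (IM.prod IS) IP ∞ e.symm e.target ∧
      ∀ p ∈ e.source, ∀ s, e (act p s) = (proj p, (e p).2 * s)

/-- The adjoint representation `Ad(s) : 𝔰 → 𝔰`, the differential at `1` of `h ↦ s h s⁻¹`. -/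
def Ad (IS : ModelWithCorners ℝ ES HS) (s : S) :
    GroupLieAlgebra IS S →L[ℝ] GroupLieAlgebra IS S :=
  mfderiv IS IS (fun h : S => s * h * s⁻¹) 1

namespace PrincipalBundle

variable (B : PrincipalBundle IM IP IS M P S)

/-- For `p, q` in the same fibre, the unique `s` with `q = p · s`; hence `ψ_m(q) = B.diff (ν m) q`
for a family `ν` of elements `ν m` of the fibres over `m`. -/
def diff (p q : P) : S :=
  open Classical in
  if h : B.proj p = B.proj q then (B.existsUnique_act p q h).choose else 1

variable (G) in
/-- The action of `G` on `P` is by bundle automorphisms: `g (p s) = (g p) s`. -/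
def IsAutomorphismGroup [MulAction G P] : Prop :=
  ∀ (g : G) (p : P) (s : S), g • B.act p s = B.act (g • p) s

/-- The induced action on the base: `(g, m) ↦ π (g p)` for a point `p` over `m`. -/
def induced [MulAction G P] (g : G) (m : M) : M :=
  B.proj (g • Function.surjInv B.surjective_proj m)

/-- A set of paths is `G`-invariant if it contains `g γ` for all `g` and all of its elements
`γ`. -/
def IsInvariant (G : Type*) [Group G] [MulAction G P] (Paths : Set (Curve M)) : Prop :=
  ∀ g : G, ∀ γ ∈ Paths, γ.map (B.induced g) ∈ Paths

end PrincipalBundle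

/-- Smooth connections: smooth `𝔰`-valued 1-forms `η` on `P` such that `R_s^* η = Ad(s⁻¹) ∘ η` and
`η` maps the value at `p` of the fundamental vector field of `X ∈ 𝔰`, which is the image of `X`
under the differential at `1` of `s ↦ p · s`, to `X`. -/
@[ext]
structure Connection [IsManifold IP ∞ P] (B : PrincipalBundle IM IP IS M P S) where
  form : (p : P) → TangentSpace IP p →L[ℝ] GroupLieAlgebra IS S
  smooth : ContMDiff IP.tangent 𝓘(ℝ, ES) (M' := ES) ∞
    fun v : TangentBundle IP P => form v.proj v.snd
  equivariant : ∀ (s : S) (p : P) (v : TangentSpace IP p),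
    form (B.act p s) (mfderiv IP IP (fun q => B.act q s) p v) = Ad IS s⁻¹ (form p v)
  fundamental : ∀ (p : P) (X : GroupLieAlgebra IS S),
    form (B.act p 1) (mfderiv IS IP (fun s => B.act p s) 1 X) = X

section Conn

set_option linter.unusedSectionVars false

variable [IsManifold IP ∞ P] (B : PrincipalBundle IM IP IS M P S)

/-- `Connection B` is regarded as a set only; so `B(Connection B)` consists of all bounded
functions. -/
instance : TopologicalSpace (Connection B) := ⊥

instance : DiscreteTopology (Connection B) := ⟨rfl⟩

variable {B}

theorem contMDiff_translation [MulAction G P] [ContMDiffSMul IG IP ∞ G P] (g : G) :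
    ContMDiff IP IP ∞ fun p : P => g • p :=
  (contMDiff_smul (I := IG) (I' := IP) (n := ∞) (G := G) (M := P)).comp
    (contMDiff_const.prodMk contMDiff_id)

theorem mdiff_right (s : S) : MDifferentiable IP IP fun q : P => B.act q s :=
  (B.contMDiff_act.comp (contMDiff_id.prodMk contMDiff_const)).mdifferentiable (by simp)

theorem mdiff_orbit (p : P) : MDifferentiable IS IP fun s : S => B.act p s :=
  (B.contMDiff_act.comp (contMDiff_const.prodMk contMDiff_id)).mdifferentiable (by simp)

theorem Connection.pull_equivariant (η : Connection B) (f : P → P) (hf : ContMDiff IP IP ∞ f)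
    (hB : ∀ p s, f (B.act p s) = B.act (f p) s) (s : S) (p : P) (v : TangentSpace IP p) :
    η.form (f (B.act p s)) (mfderiv IP IP f (B.act p s) (mfderiv IP IP (fun q => B.act q s) p v)) =
      Ad IS s⁻¹ (η.form (f p) (mfderiv IP IP f p v)) := by
  have hf' : MDifferentiable IP IP f := hf.mdifferentiable (by simp)
  have hR := mdiff_right (B := B) s
  have h1 : tangentMap IP IP f (tangentMap IP IP (fun q => B.act q s) ⟨p, v⟩) =
      tangentMap IP IP (fun q => B.act q s) (tangentMap IP IP f ⟨p, v⟩) := by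
    rw [← tangentMap_comp_at _ (hf' _) (hR _), ← tangentMap_comp_at _ (hR _) (hf' _)]
    congr 1
    funext q
    exact hB q s
  have h2 := congrArg (fun w : TangentBundle IP P => η.form w.proj w.snd) h1
  exact h2.trans (η.equivariant s (f p) (mfderiv IP IP f p v))

theorem Connection.pull_fundamental (η : Connection B) (f : P → P) (hf : ContMDiff IP IP ∞ f)
    (hB : ∀ p s, f (B.act p s) = B.act (f p) s) (p : P) (X : GroupLieAlgebra IS S) :
    η.form (f (B.act p 1)) (mfderiv IP IP f (B.act p 1) (mfderiv IS IP (fun s => B.act p s) 1 X)) =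
      X := by
  have hf' : MDifferentiable IP IP f := hf.mdifferentiable (by simp)
  have h1 : tangentMap IP IP f (tangentMap IS IP (fun s => B.act p s) ⟨1, X⟩) =
      tangentMap IS IP (fun s => B.act (f p) s) ⟨1, X⟩ := by
    rw [← tangentMap_comp_at _ (hf' _) (mdiff_orbit p _)]
    congr 1
    funext s
    exact hB p s
  have h2 := congrArg (fun w : TangentBundle IP P => η.form w.proj w.snd) h1
  exact h2.trans (η.fundamental (f p) X)

/-- The pullback `f^* η` of a connection by a bundle automorphism `f`. -/
def Connection.pull (η : Connection B) (f : P → P) (hf : ContMDiff IP IP ∞ f)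
    (hB : ∀ p s, f (B.act p s) = B.act (f p) s) : Connection B where
  form p := (η.form (f p)).comp (mfderiv IP IP f p)
  smooth := η.smooth.comp (hf.contMDiff_tangentMap (m := ∞) (by simp))
  equivariant s p v := η.pull_equivariant f hf hB s p v
  fundamental p X := η.pull_fundamental f hf hB p X

variable (IG) in
/-- The action `φ(g, η) = θ_{g⁻¹}^* η` on the set of connections. -/
def phi [MulAction G P] [ContMDiffSMul IG IP ∞ G P] (hG : B.IsAutomorphismGroup G) (g : G)
    (η : Connection B) : Connection B :=
  η.pull (fun p => g⁻¹ • p) (contMDiff_translation (IG := IG) g⁻¹) (hG g⁻¹)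

variable (IG) in
/-- The set of `G`-invariant connections. -/
def invariantConnections [MulAction G P] [ContMDiffSMul IG IP ∞ G P]
    (hG : B.IsAutomorphismGroup G) : Set (Connection B) :=
  {η | ∀ g : G, phi IG hG g η = η}

/-- `γ'` is, on `[c, d]`, a `C^1`-curve whose tangent vectors are horizontal w.r.t. `η`. -/
def IsHorizontalOn (η : Connection B) (γ' : ℝ → P) (c d : ℝ) : Prop :=
  ∃ c' < c, ∃ d' > d, ∃ δ : ℝ → P,
    ContMDiffOn 𝓘(ℝ, ℝ) IP 1 δ (Ioo c' d') ∧ EqOn γ' δ (Icc c d) ∧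
    ∀ t ∈ Icc c d, η.form (δ t) (mfderiv 𝓘(ℝ, ℝ) IP δ t (1 : ℝ)) = 0

/-- `γ'` (on `[a, b]`) is a horizontal lift, starting in `p`, of the path `γ : [a, b] → M`. -/
def IsHorizontalLift (η : Connection B) (γ : Curve M) (p : P) (γ' : ℝ → P) : Prop :=
  (∀ t : Icc γ.a γ.b, B.proj (γ' t) = γ.toFun t) ∧ γ' γ.a = p ∧
  ∃ (n : ℕ) (τ : Fin (n + 1) → ℝ), StrictMono τ ∧ τ 0 = γ.a ∧ τ (Fin.last n) = γ.b ∧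
    ∀ i : Fin n, IsHorizontalOn η γ' (τ i.castSucc) (τ i.succ)

/-- Parallel transport along `γ` w.r.t. `η`: the end point of the horizontal lift starting in `p`
(which exists and is unique for `C^1`-paths `γ` and `p` over the initial point of `γ`; the value
in the remaining cases is immaterial). -/
def transport (η : Connection B) (γ : Curve M) (p : P) : P :=
  open Classical in
  if h : ∃ γ', IsHorizontalLift η γ p γ' then h.choose γ.b else p

/-- `h_γ^ν : η ↦ ψ_{γ(b)} (transport along γ of ν_{γ(a)})`. -/
def holonomy (ν : M → P) (γ : Curve M) (η : Connection B) : S :=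
  B.diff (ν (γ.val γ.b)) (transport η γ (ν (γ.val γ.a)))

end Conn

/-! ### Cylindrical functions -/

variable (S) in
/-- Irreducible (finite-dimensional, continuous, complex) matrix representations of `S`. -/
structure IrredMatrixRep (n : ℕ) where
  toHom : S →* Matrix (Fin n) (Fin n) ℂ
  continuous_toHom : Continuous toHom
  irreducible : Representation.IsIrreducible
    (((Matrix.toLinAlgEquiv' (R := ℂ) (n := Fin n) : _ →* _).comp toHom :
      Representation ℂ S (Fin n → ℂ)))

section Cyl

variable [CompactSpace S] [IsManifold IP ∞ P] {B : PrincipalBundle IM IP IS M P S}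

/-- The function `ρ_ij ∘ h_γ^ν`, an element of `B(Connection B)`. -/
def generator {n : ℕ} (ρ : IrredMatrixRep S n) (i j : Fin n) (ν : M → P) (γ : Curve M) :
    BoundedContinuousFunction (Connection B) ℂ :=
  (BoundedContinuousFunction.mkOfCompact
    ⟨fun s : S => ρ.toHom s i j, ρ.continuous_toHom.matrix_elem i j⟩).compContinuous
      ⟨holonomy (B := B) ν γ, continuous_of_discreteTopology⟩

theorem generator_apply {n : ℕ} (ρ : IrredMatrixRep S n) (i j : Fin n) (ν : M → P) (γ : Curve M)
    (η : Connection B) : generator ρ i j ν γ η = ρ.toHom (holonomy ν γ η) i j := rfl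

variable (B) in
/-- The set of all the functions `ρ_ij ∘ h_γ^ν`, `γ ∈ Paths`. -/
def generators (ν : M → P) (Paths : Set (Curve M)) :
    Set (BoundedContinuousFunction (Connection B) ℂ) :=
  {f | ∃ (n : ℕ) (ρ : IrredMatrixRep S n) (i j : Fin n), ∃ γ ∈ Paths, f = generator ρ i j ν γ}

variable (B) in
/-- The C*-algebra of cylindrical functions: the closure in `B(Connection B)` of the *-algebra
generated by the functions `ρ_ij ∘ h_γ^ν`. -/
def Cyl (ν : M → P) (Paths : Set (Curve M)) :
    StarSubalgebra ℂ (BoundedContinuousFunction (Connection B) ℂ) :=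
  (StarAlgebra.adjoin ℂ (generators B ν Paths)).topologicalClosure

instance (ν : M → P) (Paths : Set (Curve M)) : CompleteSpace (Cyl B ν Paths) :=
  inferInstanceAs (CompleteSpace (StarSubalgebra.topologicalClosure _))

variable (B) in
/-- The space of generalized connections, the spectrum of the cylindrical functions. -/
abbrev GenConnection (ν : M → P) (Paths : Set (Curve M)) : Type _ :=
  WeakDual.characterSpace ℂ (Cyl B ν Paths)

variable (IG) in
/-- `Φ` is a left action of `G` on the generalized connections with continuous translations `Φ_g`
which extends `φ` in the sense that `Φ_g ∘ ι = ι ∘ φ_g` for all `g`. -/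
structure IsExtendedAction [MulAction G P] [ContMDiffSMul IG IP ∞ G P]
    (hG : B.IsAutomorphismGroup G) (ν : M → P) (Paths : Set (Curve M))
    (Φ : G → GenConnection B ν Paths → GenConnection B ν Paths) : Prop where
  one : ∀ χ, Φ 1 χ = χ
  mul : ∀ g h χ, Φ (g * h) χ = Φ g (Φ h χ)
  continuous_translation : ∀ g, Continuous (Φ g)
  extends_phi : ∀ g (η : Connection B),
    Φ g (iota (Cyl B ν Paths) η) = iota (Cyl B ν Paths) (phi IG hG g η)

variable (IG) in
/-- The map `Φ(g, χ) = χ ∘ φ_g^*`, given that `φ_g^*` maps the cylindrical functions to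
cylindrical functions. -/
def specAction [MulAction G P] [ContMDiffSMul IG IP ∞ G P]
    (hG : B.IsAutomorphismGroup G) (ν : M → P) (Paths : Set (Curve M))
    (h : ∀ g : G, ∀ f ∈ Cyl B ν Paths, pullback (phi IG hG g) f ∈ Cyl B ν Paths) (g : G) :
    GenConnection B ν Paths → GenConnection B ν Paths :=
  specMap (Cyl B ν Paths) (Cyl B ν Paths) (phi IG hG g) (h g)

variable (IG) in
/-- The map from the quantized reduced space, the spectrum of the restriction C*-algebra of the
cylindrical functions to the invariant connections, to the generalized connections, which is
dual to the restriction homomorphism. -/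
def reducedMap [MulAction G P] [ContMDiffSMul IG IP ∞ G P]
    (hG : B.IsAutomorphismGroup G) (ν : M → P) (Paths : Set (Curve M)) :
    WeakDual.characterSpace ℂ
      (restrAlg (Cyl B ν Paths) (Subtype.val : invariantConnections IG hG → Connection B)) →
    GenConnection B ν Paths :=
  specMap (Cyl B ν Paths) _ Subtype.val (pullback_mem_restrAlg _ _)

end Cyl

end GenConn

/-!
The statement splits into a geometric fact, that translation by `G` preserves cylindrical functions,
and into the Gelfand theory of algebras of bounded functions.

*Geometry.* The horizontal lift of a path with respect to `φ(g, η) = θ_{g⁻¹}^* η` is mapped by `g⁻¹`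
to the horizontal lift with respect to `η` of the translated path. Therefore the holonomy of
`φ(g, η)` along `γ` equals `s₂ h s₁`, where `h` is the holonomy of `η` along `g⁻¹ γ`, and `s₁`, `s₂`
only depend on the chosen points of the fibres (`exists_holonomy_phi_eq`). Matrix coefficients of
`s₂ h s₁` are linear combinations of those of `h`, so `φ_g^*` preserves `Cyl`
(`pullback_mem_Cyl`). For this, parallel transport has to be well defined:

* Horizontal lifts are unique (`IsHorizontalLift.eqOn`). Two lifts differ by a curve `s` in the
  structure group, and the product rule `η((p s)') = Ad(s⁻¹) η(p') + s⁻¹ s'`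
  (`Connection.form_mfderiv_act`) shows that `s` has vanishing velocity.
* Horizontal lifts exist (`exists_isHorizontalLift`). By compactness of the interval and right
  translation it suffices to lift locally. Given a local section `p` along the path, solve
  `u⁻¹ u' = η(p')` in the structure group (`exists_curve_leftLogDeriv_eq`); then `p u⁻¹` is
  horizontal.

*Spectra.* For a complete unital *-algebra `A` of bounded functions on a set, the set is dense in
the spectrum of `A` (`denseRange_iota`), which gives uniqueness of the extended action. The
restriction map to a subset is dual to an embedding of the spectrum of the restriction algebra, and
its image is the closure of the subset by density and compactness (`range_specMap_restrAlg`).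
Finally, since `A` is isometric to the continuous functions on its compact spectrum, joint
continuity of the action on the spectrum is the same as continuity of the orbit maps `g ↦ φ_g^* f`
in norm (`continuous_specMap_iff`); the functions with a continuous orbit map form a closed
*-subalgebra, so generators suffice (`continuous_pullback_of_generators`).
-/

namespace GenConn

/-! ### Spectra of algebras of bounded functions -/

section SpectraLemmas

set_option linter.unusedSectionVars false

variable {X Y : Type*} [TopologicalSpace X] [TopologicalSpace Y]
  [DiscreteTopology X] [DiscreteTopology Y]

/-- A complete unital *-subalgebra of `B(X)` is a commutative C*-algebra. -/
@[reducible] def commCStarAlgebra (A : StarSubalgebra ℂ (BoundedContinuousFunction X ℂ))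
    [CompleteSpace A] : CommCStarAlgebra A where
  norm_mul_self_le x := CStarRing.norm_star_mul_self
    (x := (x : BoundedContinuousFunction X ℂ)) |>.symm.le
  mul_comm _ _ := mul_comm _ _

theorem isometry_gelfandTransform (A : StarSubalgebra ℂ (BoundedContinuousFunction X ℂ))
    [CompleteSpace A] : Isometry (WeakDual.gelfandTransform ℂ A) :=
  letI := commCStarAlgebra A
  gelfandTransform_isometry A

theorem surjective_gelfandTransform (A : StarSubalgebra ℂ (BoundedContinuousFunction X ℂ))
    [CompleteSpace A] : Function.Surjective (WeakDual.gelfandTransform ℂ A) :=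
  letI := commCStarAlgebra A
  (gelfandTransform_bijective A).2

/-- The points of `X` are dense in the spectrum: a continuous function on the spectrum which
separates a character from their closure would be the Gelfand transform of a function on `X` which
vanishes identically. -/
theorem denseRange_iota (A : StarSubalgebra ℂ (BoundedContinuousFunction X ℂ))
    [CompleteSpace A] : DenseRange (iota A) := by
  intro χ
  by_contra hχ
  obtain ⟨f, hf0, hf1, -⟩ := exists_continuous_zero_one_of_isClosed
    (isClosed_closure (s := range (iota A))) (isClosed_singleton (x := χ))
    (disjoint_singleton_right.2 hχ)
  obtain ⟨a, ha⟩ := surjective_gelfandTransform A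
    ⟨fun χ => (f χ : ℂ), Complex.continuous_ofReal.comp f.continuous⟩
  have hval (ψ : WeakDual.characterSpace ℂ A) : ψ a = (f ψ : ℂ) :=
    congrArg (fun F : C(WeakDual.characterSpace ℂ A, ℂ) => F ψ) ha
  have ha0 : a = 0 := by
    refine Subtype.ext (BoundedContinuousFunction.ext fun x => ?_)
    have h := hval (iota A x)
    rw [hf0 (subset_closure (mem_range_self x)), iota_apply] at h
    simpa using h
  have h1 := hval χ
  rw [hf1 rfl, ha0, map_zero] at h1
  simp at h1

theorem continuous_specMap (A : StarSubalgebra ℂ (BoundedContinuousFunction X ℂ))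
    (B : StarSubalgebra ℂ (BoundedContinuousFunction Y ℂ))
    [CompleteSpace A] [CompleteSpace B] (u : Y → X) (h : ∀ f ∈ A, pullback u f ∈ B) :
    Continuous (specMap A B u h) :=
  ContinuousMap.continuous _

theorem norm_pullback_le (u : Y → X) (f : BoundedContinuousFunction X ℂ) :
    ‖pullback u f‖ ≤ ‖f‖ :=
  BoundedContinuousFunction.norm_le (norm_nonneg _) |>.2 fun y => f.norm_coe_le_norm (u y)

theorem continuous_pullback (u : Y → X) : Continuous (pullback u) :=
  AddMonoidHomClass.continuous_of_bound (pullback u) 1 fun f => by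
    simpa using norm_pullback_le u f

/-- The spectrum of the restriction algebra embeds into the spectrum: a character of the
restriction algebra is determined by its values on the dense subalgebra of restrictions. -/
theorem injective_specMap_restrAlg (A : StarSubalgebra ℂ (BoundedContinuousFunction X ℂ))
    [CompleteSpace A] (u : Y → X) :
    Function.Injective (specMap A (restrAlg A u) u (pullback_mem_restrAlg A u)) := by
  intro χ ψ h
  refine Subtype.ext (ContinuousLinearMap.ext fun f => ?_)
  have hdense : Dense {g : restrAlg A u | (g : BoundedContinuousFunction Y ℂ) ∈
      A.map (pullback u)} := by
    intro g
    rw [closure_subtype]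
    refine closure_mono ?_ g.2
    rintro _ ⟨f, hf, rfl⟩
    exact ⟨⟨pullback u f, pullback_mem_restrAlg A u f hf⟩, ⟨f, hf, rfl⟩, rfl⟩
  refine congrFun (Continuous.ext_on (f := fun g => χ g) (g := fun g => ψ g) hdense
    (map_continuous χ) (map_continuous ψ) ?_) f
  rintro ⟨_, hg⟩ ⟨f, hf, rfl⟩
  exact congrArg (fun φ : WeakDual.characterSpace ℂ A => φ ⟨f, hf⟩) h

theorem isClosedEmbedding_specMap_restrAlg
    (A : StarSubalgebra ℂ (BoundedContinuousFunction X ℂ)) [CompleteSpace A] (u : Y → X) :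
    IsClosedEmbedding (specMap A (restrAlg A u) u (pullback_mem_restrAlg A u)) :=
  (continuous_specMap _ _ _ _).isClosedEmbedding (injective_specMap_restrAlg A u)

theorem range_specMap_restrAlg (A : StarSubalgebra ℂ (BoundedContinuousFunction X ℂ))
    [CompleteSpace A] (u : Y → X) :
    range (specMap A (restrAlg A u) u (pullback_mem_restrAlg A u)) =
      closure (iota A '' range u) := by
  have h := (isClosedEmbedding_specMap_restrAlg A u).isClosedMap.closure_image_eq_of_continuous
    (continuous_specMap _ _ _ _) (range (iota (restrAlg A u)))
  rw [(denseRange_iota _).closure_range, image_univ, ← range_comp] at h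
  rw [← h, ← range_comp]
  rfl

/-- Pulling back all elements of a *-algebra along a family `u` of maps is continuous in the
parameter as soon as this holds for generators, since the admissible functions form a closed
*-subalgebra. -/
theorem continuous_pullback_of_generators {G : Type*} [TopologicalSpace G] (u : G → X → X)
    (s : Set (BoundedContinuousFunction X ℂ)) (hs : ∀ f ∈ s, Continuous fun g => pullback (u g) f)
    {f : BoundedContinuousFunction X ℂ} (hf : f ∈ (StarAlgebra.adjoin ℂ s).topologicalClosure) :
    Continuous fun g => pullback (u g) f := by
  let T : StarSubalgebra ℂ (BoundedContinuousFunction X ℂ) :=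
    { carrier := {f | Continuous fun g => pullback (u g) f}
      mul_mem' := fun {a b} ha hb => by
        change Continuous fun g => pullback (u g) (a * b)
        simp only [map_mul]
        exact Continuous.mul ha hb
      add_mem' := fun {a b} ha hb => by
        change Continuous fun g => pullback (u g) (a + b)
        simp only [map_add]
        exact Continuous.add ha hb
      algebraMap_mem' := fun c => by
        change Continuous fun g => pullback (u g) (algebraMap ℂ _ c)
        simp only [AlgHomClass.commutes]
        exact continuous_const
      star_mem' := fun {a} ha => by
        change Continuous fun g => pullback (u g) (star a)
        simp only [map_star]
        exact Continuous.star ha }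
  have hT : IsClosed (T : Set (BoundedContinuousFunction X ℂ)) := by
    refine isClosed_of_closure_subset fun f hf => ?_
    refine continuous_of_uniform_approx_of_continuous fun v hv => ?_
    obtain ⟨ε, hε, hεv⟩ := Metric.mem_uniformity_dist.1 hv
    obtain ⟨f', hf', hd⟩ := Metric.mem_closure_iff.1 hf ε hε
    refine ⟨fun g => pullback (u g) f', hf', fun g => hεv ?_⟩
    rw [dist_eq_norm, ← map_sub]
    exact (norm_pullback_le _ _).trans_lt (by rwa [← dist_eq_norm])
  exact StarSubalgebra.topologicalClosure_minimal (t := T)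
    (StarAlgebra.adjoin_le fun f hf => hs f hf) hT hf

/-- Joint continuity of `(g, χ) ↦ χ ∘ u_g^*` on `G × Spec(A)` amounts to norm continuity of the
orbit maps `g ↦ u_g^* f`. As `Spec(A)` is compact, both are continuity of
`g ↦ (χ ↦ χ (u_g^* f))` for the topology of uniform convergence on `Spec(A)`, the Gelfand transform
being isometric. -/
theorem continuous_specMap_iff {G : Type*} [TopologicalSpace G]
    (A : StarSubalgebra ℂ (BoundedContinuousFunction X ℂ)) [CompleteSpace A] (u : G → X → X)
    (h : ∀ g, ∀ f ∈ A, pullback (u g) f ∈ A) :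
    Continuous (fun x : G × WeakDual.characterSpace ℂ A => specMap A A (u x.1) (h x.1) x.2) ↔
      ∀ f : A, Continuous fun g => (⟨pullback (u g) f, h g f f.2⟩ : A) := by
  have hG := isometry_gelfandTransform A
  constructor
  · intro hc f
    rw [hG.isEmbedding.continuous_iff]
    exact (ContinuousMap.curry
      ⟨fun x : G × WeakDual.characterSpace ℂ A => specMap A A (u x.1) (h x.1) x.2 f,
        (WeakDual.gelfandTransform ℂ A f).continuous.comp hc⟩).continuous
  · intro hc
    refine Continuous.subtype_mk (WeakDual.continuous_of_continuous_eval fun f => ?_) _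
    exact ((hG.continuous.comp (hc f)).comp continuous_fst).eval continuous_snd

end SpectraLemmas

/-! ### Curves in a Lie group with prescribed logarithmic derivative -/

section LogDeriv

/-- Local solvability of the non-autonomous equation `y' = K(y) A(t)` with `A` merely continuous
and `K` of class `C^1`. -/
theorem exists_hasDerivAt_clm_apply {E F : Type*} [NormedAddCommGroup E] [NormedSpace ℝ E]
    [CompleteSpace E] [NormedAddCommGroup F] [NormedSpace ℝ F] {K : E → F →L[ℝ] E} {x₀ : E}
    (hK : ContDiffAt ℝ 1 K x₀) {A : ℝ → F} {s : Set ℝ} (hs : IsOpen s) (hA : ContinuousOn A s)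
    {t₀ : ℝ} (ht₀ : t₀ ∈ s) :
    ∃ y : ℝ → E, y t₀ = x₀ ∧ ∃ ε > 0, Ioo (t₀ - ε) (t₀ + ε) ⊆ s ∧
      ∀ t ∈ Ioo (t₀ - ε) (t₀ + ε), HasDerivAt y (K (y t) (A t)) t := by
  obtain ⟨c, V, hV, hl⟩ := hK.exists_lipschitzOnWith
  have hb : ∀ᶠ x in 𝓝 x₀, ‖K x‖ < ‖K x₀‖ + 1 :=
    hK.continuousAt.norm.eventually_lt_const (lt_add_one _)
  obtain ⟨a, ha, haV⟩ := Metric.nhds_basis_closedBall.mem_iff.1 (Filter.inter_mem hV hb)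
  have hb' : ∀ᶠ t in 𝓝 t₀, ‖A t‖ < ‖A t₀‖ + 1 :=
    (hA.continuousAt (hs.mem_nhds ht₀)).norm.eventually_lt_const (lt_add_one _)
  obtain ⟨δ, hδ, hδs⟩ := Metric.nhds_basis_closedBall.mem_iff.1
    (Filter.inter_mem (hs.mem_nhds ht₀) hb')
  -- `D` bounds the right-hand side
  let D : NNReal := .mk ((‖K x₀‖ + 1) * (‖A t₀‖ + 1)) (by positivity)
  have hD : 0 < (D : ℝ) := by change 0 < (‖K x₀‖ + 1) * (‖A t₀‖ + 1); positivity
  let ε := min δ (a / D)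
  have hε : 0 < ε := lt_min hδ (by positivity)
  have hsub : Icc (t₀ - ε) (t₀ + ε) ⊆ Metric.closedBall t₀ δ := by
    rw [← Real.closedBall_eq_Icc]
    exact Metric.closedBall_subset_closedBall (min_le_left _ _)
  have hpl : IsPicardLindelof (fun t x => K x (A t)) (tmin := t₀ - ε) (tmax := t₀ + ε)
      ⟨t₀, by simp [hε.le]⟩ x₀ (.mk a ha.le) 0 D
      (c * .mk (‖A t₀‖ + 1) (by positivity)) := by
    refine ⟨fun t ht => ?_, fun x _ => ?_, fun t ht x hx => ?_, ?_⟩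
    · refine LipschitzOnWith.of_dist_le_mul fun x hx y hy => ?_
      have h1 := hl.dist_le_mul x (haV hx).1 y (haV hy).1
      have h2 : ‖A t‖ ≤ ‖A t₀‖ + 1 := (hδs (hsub ht)).2.le
      calc dist (K x (A t)) (K y (A t)) = ‖(K x - K y) (A t)‖ := by
            rw [dist_eq_norm, sub_apply]
        _ ≤ ‖K x - K y‖ * ‖A t‖ := ContinuousLinearMap.le_opNorm _ _
        _ ≤ (c * dist x y) * (‖A t₀‖ + 1) := by
            rw [← dist_eq_norm]; gcongr
        _ = _ := by rw [NNReal.coe_mul, NNReal.coe_mk]; ring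
    · exact ContinuousOn.clm_apply continuousOn_const
        (hA.mono fun t ht => (hδs (hsub ht)).1)
    · have h2 : ‖A t‖ ≤ ‖A t₀‖ + 1 := (hδs (hsub ht)).2.le
      have h1 : ‖K x‖ ≤ ‖K x₀‖ + 1 := (haV hx).2.le
      exact (ContinuousLinearMap.le_opNorm _ _).trans
        (mul_le_mul h1 h2 (norm_nonneg _) (by positivity))
    · have : ε ≤ a / D := min_le_right _ _
      rw [le_div_iff₀ hD] at this
      simp only [add_sub_cancel_left, sub_sub_cancel, max_self, NNReal.coe_mk, NNReal.coe_zero,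
        sub_zero]
      linarith
  obtain ⟨y, hy0, hy⟩ := hpl.exists_eq_forall_mem_Icc_hasDerivWithinAt₀
  exact ⟨y, hy0, ε, hε, fun t ht => (hδs (hsub (Ioo_subset_Icc_self ht))).1, fun t ht =>
    (hy t (Ioo_subset_Icc_self ht)).hasDerivAt (Icc_mem_nhds ht.1 ht.2)⟩

variable {ES HS S : Type*} [NormedAddCommGroup ES] [NormedSpace ℝ ES]
  [TopologicalSpace HS] (IS : ModelWithCorners ℝ ES HS)
  [TopologicalSpace S] [ChartedSpace HS S] [Group S]

/-- The left logarithmic derivative `u(t)⁻¹ u'(t)` of a curve in a Lie group, defined as the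
velocity at time `t` of the curve `τ ↦ u(t)⁻¹ u(τ)`, which passes through `1` at that time. -/
def leftLogDeriv (u : ℝ → S) (t : ℝ) : GroupLieAlgebra IS S :=
  mfderiv 𝓘(ℝ, ℝ) IS (fun τ => (u t)⁻¹ * u τ) t (1 : ℝ)

/-- For a continuous curve `A` in the Lie algebra, there is locally a `C^1`-curve `u` in the Lie
group with `u(t₀) = 1` and left logarithmic derivative `A`. -/
theorem exists_curve_leftLogDeriv_eq [CompleteSpace ES] [IS.Boundaryless] [LieGroup IS ∞ S]
    {A : ℝ → GroupLieAlgebra IS S}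
    {s : Set ℝ} (hs : IsOpen s) (hA : ContinuousOn A s) {t₀ : ℝ} (ht₀ : t₀ ∈ s) :
    ∃ u : ℝ → S, u t₀ = 1 ∧ ∃ ε > 0, Ioo (t₀ - ε) (t₀ + ε) ⊆ s ∧
      ContMDiffOn 𝓘(ℝ, ℝ) IS 1 u (Ioo (t₀ - ε) (t₀ + ε)) ∧
      ∀ t ∈ Ioo (t₀ - ε) (t₀ + ε), leftLogDeriv IS u t = A t := by
  have : IsManifold IS ∞ S := inferInstanceAs (IsManifold IS ∞ S)
  have : IsManifold IS 1 S := IsManifold.of_le (n := ∞) (by simp)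
  let e := extChartAt IS (1 : S)
  let x₀ : ES := e 1
  have hT : IsOpen e.target := isOpen_extChartAt_target 1
  have hx₀ : x₀ ∈ e.target := mem_extChartAt_target 1
  have hex₀ : e.symm x₀ = 1 := e.left_inv (mem_extChartAt_source 1)
  have hsymm {x : ES} (hx : x ∈ e.target) : ContMDiffAt 𝓘(ℝ, ES) IS ∞ e.symm x :=
    (contMDiffOn_extChartAt_symm (1 : S)).contMDiffAt (hT.mem_nhds hx)
  -- the multiplication in the chart at `1`
  let m : ES → ES → ES := fun y x => e (e.symm y * e.symm x)
  have hm : ContDiffAt ℝ ∞ (Function.uncurry m) (x₀, x₀) := by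
    rw [← contMDiffAt_iff_contDiffAt]
    have h1 : ContMDiffAt 𝓘(ℝ, ES × ES) IS ∞ (fun z : ES × ES => e.symm z.1 * e.symm z.2)
        (x₀, x₀) := by
      refine ContMDiffAt.mul ?_ ?_
      · exact ContMDiffAt.comp (g := e.symm) (f := Prod.fst) (x₀, x₀) (hsymm hx₀)
          contDiff_fst.contMDiff.contMDiffAt
      · exact ContMDiffAt.comp (g := e.symm) (f := Prod.snd) (x₀, x₀) (hsymm hx₀)
          contDiff_snd.contMDiff.contMDiffAt
    refine ContMDiffAt.comp (g := e) (x₀, x₀) (contMDiffAt_extChartAt' ?_) h1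
    simp [hex₀]
  -- `K y` is the differential at `1` of the left translation by the point with coordinates `y`
  let K : ES → ES →L[ℝ] ES := fun y => fderiv ℝ (m y) x₀
  have hK : ContDiffAt ℝ 1 K x₀ := ContDiffAt.fderiv hm contDiffAt_const
    (WithTop.coe_le_coe.2 (le_top : (1 + 1 : ℕ∞) ≤ ⊤))
  obtain ⟨y, hy0, ε₁, hε₁, hs₁, hy⟩ := exists_hasDerivAt_clm_apply hK hs hA ht₀
  have hyc : ContinuousAt y t₀ := (hy t₀ (by simp [hε₁])).continuousAt
  have hgood : ∀ᶠ t in 𝓝 t₀, t ∈ Ioo (t₀ - ε₁) (t₀ + ε₁) ∧ y t ∈ e.target ∧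
      ContDiffAt ℝ 1 K (y t) := by
    refine Filter.Eventually.and (Ioo_mem_nhds (by linarith) (by linarith))
      (Filter.Eventually.and (hyc.eventually ?_) (hyc.eventually ?_))
    · rw [hy0]; exact hT.mem_nhds hx₀
    · rw [hy0]; exact hK.eventually (by simp)
  obtain ⟨ε, hε, hball⟩ := Metric.eventually_nhds_iff_ball.1 hgood
  rw [Real.ball_eq_Ioo] at hball
  have hyC : ContDiffOn ℝ 1 y (Ioo (t₀ - ε) (t₀ + ε)) := by
    have hd : ∀ t ∈ Ioo (t₀ - ε) (t₀ + ε), deriv y t = K (y t) (A t) := fun t ht =>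
      (hy t (hball t ht).1).deriv
    rw [show (1 : ℕ∞ω) = 0 + 1 by simp, contDiffOn_succ_iff_deriv_of_isOpen isOpen_Ioo]
    refine ⟨fun t ht => (hy t (hball t ht).1).differentiableAt.differentiableWithinAt, by simp, ?_⟩
    rw [contDiffOn_zero]
    refine ContinuousOn.congr (fun t ht => ?_) hd
    exact (ContinuousAt.clm_apply ((hball t ht).2.2.continuousAt.comp
      (f := y) (hy t (hball t ht).1).continuousAt)
      (hA.continuousAt (hs.mem_nhds (hs₁ (hball t ht).1)))).continuousWithinAt
  refine ⟨fun t => e.symm (y t), by simp [hy0, hex₀], ε, hε, fun t ht => hs₁ (hball t ht).1,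
    ?_, fun t ht => ?_⟩
  · exact ((contMDiffOn_extChartAt_symm (n := 1) (1 : S))).comp hyC.contMDiffOn
      fun t ht => (hball t ht).2.1
  · obtain ⟨htI, htT, -⟩ := hball t ht
    have hmx₀ : m (y t) x₀ = y t := by
      simp only [m, hex₀, mul_one]; exact e.right_inv htT
    -- `g` is left inverse, in the chart, to the left translation by `u t`; hence it maps
    -- `y'(t) = K (y t) (A t)` back to `A t`
    let g : ES → S := fun x => (e.symm (y t))⁻¹ * e.symm x
    have hg : MDifferentiableAt 𝓘(ℝ, ES) IS g (y t) :=
      ContMDiffAt.mdifferentiableAt (n := ∞) (contMDiffAt_const.mul (hsymm htT)) (by simp)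
    have hprod : ContMDiffAt 𝓘(ℝ, ES) IS ∞ (fun x => e.symm (y t) * e.symm x) x₀ :=
      contMDiffAt_const.mul (hsymm hx₀)
    have hsrc : e.symm (y t) * e.symm x₀ ∈ e.source := by
      rw [hex₀, mul_one]; exact e.map_target htT
    have hmt : MDifferentiableAt 𝓘(ℝ, ES) 𝓘(ℝ, ES) (m (y t)) x₀ :=
      ContMDiffAt.mdifferentiableAt (n := ∞) (ContMDiffAt.comp (g := e) x₀
        (contMDiffAt_extChartAt' (by rwa [extChartAt_source] at hsrc)) hprod) (by simp)
    have hcomp : (g ∘ m (y t)) =ᶠ[𝓝 x₀] e.symm := by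
      filter_upwards [hprod.continuousAt.eventually
        ((isOpen_extChartAt_source (I := IS) (1 : S)).mem_nhds hsrc)] with x hx
      simp only [g, m, Function.comp]
      rw [e.left_inv hx, inv_mul_cancel_left]
    have hd : HasMFDerivAt 𝓘(ℝ, ES) IS e.symm x₀ (mfderiv 𝓘(ℝ, ES) IS e.symm x₀) :=
      ((hsymm hx₀).mdifferentiableAt (by simp)).hasMFDerivAt
    have hid : mfderiv 𝓘(ℝ, ES) IS e.symm x₀ = ContinuousLinearMap.id ℝ ES := by
      have := mfderivWithin_range_extChartAt_symm (I := IS) (x := (1 : S))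
      rwa [IS.range_eq_univ, mfderivWithin_univ] at this
    have h1 : HasMFDerivAt 𝓘(ℝ, ES) IS (g ∘ m (y t)) x₀
        ((mfderiv 𝓘(ℝ, ES) IS g (y t)).comp (K (y t))) := by
      refine HasMFDerivAt.comp (I' := 𝓘(ℝ, ES)) x₀ ?_ ?_
      · rw [hmx₀]; exact hg.hasMFDerivAt
      · have := hmt.hasMFDerivAt
        rwa [mfderiv_eq_fderiv] at this
    have h2 := hasMFDerivAt_unique h1 (hd.congr_of_eventuallyEq hcomp)
    rw [hid] at h2
    have h3 : mfderiv 𝓘(ℝ, ℝ) IS (g ∘ y) t (1 : ℝ) =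
        mfderiv 𝓘(ℝ, ES) IS g (y t) (K (y t) (A t)) := by
      rw [mfderiv_comp (I' := 𝓘(ℝ, ES)) t hg (hy t htI).differentiableAt.mdifferentiableAt,
        mfderiv_eq_fderiv]
      change mfderiv 𝓘(ℝ, ES) IS g (y t) (fderiv ℝ y t (1 : ℝ)) = _
      rw [fderiv_apply_one_eq_deriv, (hy t htI).deriv]
    exact h3.trans (congrArg (fun T : ES →L[ℝ] ES => T (A t)) h2)

end LogDeriv

/-! ### Partitions of intervals -/

/-- A partition of `[a, b]` all of whose intervals satisfy `r` is the same as a chain of such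
intervals. -/
theorem exists_partition_iff_reflTransGen (r : ℝ → ℝ → Prop) (a b : ℝ) :
    (∃ (n : ℕ) (τ : Fin (n + 1) → ℝ), StrictMono τ ∧ τ 0 = a ∧ τ (Fin.last n) = b ∧
      ∀ i : Fin n, r (τ i.castSucc) (τ i.succ)) ↔
    Relation.ReflTransGen (fun c d => c < d ∧ r c d) a b := by
  constructor
  · rintro ⟨n, τ, hτ, h0, h1, hr⟩
    induction n generalizing b with
    | zero => subst h0 h1; exact .refl
    | succ n ih =>
      refine .tail (ih _ (fun i => τ i.castSucc) (hτ.comp Fin.strictMono_castSucc) h0 rfl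
        fun i => hr i.castSucc) ?_
      rw [← h1]
      exact ⟨hτ (Fin.castSucc_lt_last _), hr (Fin.last n)⟩
  · intro h
    induction h with
    | refl => exact ⟨0, fun _ => a, fun i j h => (h.ne (Subsingleton.elim (α := Fin 1) i j)).elim,
        rfl, rfl, fun i => i.elim0⟩
    | @tail c d _ hcd ih =>
      obtain ⟨n, τ, hτ, h0, h1, hr⟩ := ih
      have key : ∀ i : Fin (n + 1), Fin.snoc (α := fun _ => ℝ) τ d i.castSucc <
          Fin.snoc (α := fun _ => ℝ) τ d i.succ ∧ r (Fin.snoc (α := fun _ => ℝ) τ d i.castSucc)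
          (Fin.snoc (α := fun _ => ℝ) τ d i.succ) := by
        intro i
        induction i using Fin.lastCases with
        | last => simpa only [Fin.snoc_castSucc, Fin.succ_last, Fin.snoc_last, h1] using hcd
        | cast j =>
          simp only [Fin.snoc_castSucc, Fin.succ_castSucc]
          exact ⟨hτ Fin.castSucc_lt_succ, hr j⟩
      refine ⟨n + 1, Fin.snoc (α := fun _ => ℝ) τ d,
        Fin.strictMono_iff_lt_succ.2 fun i => (key i).1, ?_, Fin.snoc_last _ _, fun i => (key i).2⟩
      rw [← Fin.castSucc_zero, Fin.snoc_castSucc, h0]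

/-! ### Elementary properties of principal bundles -/

variable {EM HM M EP HP P ES HS S EG HG G : Type*}
  [NormedAddCommGroup EM] [NormedSpace ℝ EM] [TopologicalSpace HM]
  {IM : ModelWithCorners ℝ EM HM} [TopologicalSpace M] [ChartedSpace HM M]
  [NormedAddCommGroup EP] [NormedSpace ℝ EP] [TopologicalSpace HP]
  {IP : ModelWithCorners ℝ EP HP} [TopologicalSpace P] [ChartedSpace HP P]
  [NormedAddCommGroup ES] [NormedSpace ℝ ES] [TopologicalSpace HS]
  {IS : ModelWithCorners ℝ ES HS} [TopologicalSpace S] [ChartedSpace HS S] [Group S]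
  [NormedAddCommGroup EG] [NormedSpace ℝ EG] [TopologicalSpace HG]
  {IG : ModelWithCorners ℝ EG HG} [TopologicalSpace G] [ChartedSpace HG G] [Group G]

section Bundle

set_option linter.unusedSectionVars false

variable {B : PrincipalBundle IM IP IS M P S}

theorem PrincipalBundle.act_diff {p q : P} (h : B.proj p = B.proj q) :
    B.act p (B.diff p q) = q := by
  rw [PrincipalBundle.diff, dif_pos h]
  exact (B.existsUnique_act p q h).choose_spec.1.symm

theorem PrincipalBundle.act_injective (p : P) : Function.Injective (B.act p) := fun s _ h =>
  (B.existsUnique_act p (B.act p s) (B.proj_act p s).symm).unique rfl h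

theorem PrincipalBundle.diff_act (p : P) (s : S) : B.diff p (B.act p s) = s :=
  PrincipalBundle.act_injective p (PrincipalBundle.act_diff (B.proj_act p s).symm)

theorem PrincipalBundle.act_act_inv (p : P) (s : S) : B.act (B.act p s⁻¹) s = p := by
  rw [← B.act_mul, inv_mul_cancel, B.act_one]

/-- A local trivialization covers the identity of the base. -/
theorem PrincipalBundle.fst_trivialization {e : OpenPartialHomeomorph P (M × S)}
    (he : ∀ p ∈ e.source, ∀ s, e (B.act p s) = (B.proj p, (e p).2 * s)) {p : P}
    (hp : p ∈ e.source) : (e p).1 = B.proj p := by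
  have := congrArg Prod.fst (he p hp 1)
  rwa [B.act_one] at this

theorem PrincipalBundle.proj_smul [MulAction G P] (hG : B.IsAutomorphismGroup G) (g : G) (p : P) :
    B.proj (g • p) = B.induced g (B.proj p) := by
  have h : B.proj (Function.surjInv B.surjective_proj (B.proj p)) = B.proj p :=
    Function.surjInv_eq _ _
  rw [PrincipalBundle.induced]
  conv_lhs => rw [← PrincipalBundle.act_diff h, hG, B.proj_act]

end Bundle

/-! ### The product rule for connections -/

section ProductRule

set_option linter.unusedSectionVars false

variable [IsManifold IP ∞ P] [LieGroup IS ∞ S] {B : PrincipalBundle IM IP IS M P S}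

/-- The value `η(p'(t))` of a connection on the velocity of a curve. -/
def Connection.onVelocity (η : Connection B) (p : ℝ → P) (t : ℝ) : GroupLieAlgebra IS S :=
  η.form (p t) (mfderiv 𝓘(ℝ, ℝ) IP p t (1 : ℝ))

/-- Connections reproduce the velocities of curves through `1` in the structure group. -/
theorem Connection.form_mfderiv_orbit (η : Connection B) (q : P) {c : ℝ → S} {t : ℝ}
    (hc : MDifferentiableAt 𝓘(ℝ, ℝ) IS c t) (h1 : c t = 1) :
    η.onVelocity (fun τ => B.act q (c τ)) t =
      mfderiv 𝓘(ℝ, ℝ) IS c t (1 : ℝ) := by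
  have h2 : tangentMap 𝓘(ℝ, ℝ) IP (fun τ => B.act q (c τ)) ⟨t, (1 : ℝ)⟩ =
      tangentMap IS IP (fun s => B.act q s) (tangentMap 𝓘(ℝ, ℝ) IS c ⟨t, (1 : ℝ)⟩) :=
    tangentMap_comp_at (I' := IS) (g := fun s => B.act q s) ⟨t, (1 : ℝ)⟩ (mdiff_orbit q _) hc
  -- tangent spaces at different points are copies of the model space, so that base points may be
  -- exchanged along equalities
  have h3 : ∀ (s : S) (w : ES), s = 1 → (⟨s, w⟩ : TangentBundle IS S) = ⟨1, w⟩ := by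
    rintro s w rfl; rfl
  have h4 : tangentMap 𝓘(ℝ, ℝ) IS c ⟨t, (1 : ℝ)⟩ = ⟨1, mfderiv 𝓘(ℝ, ℝ) IS c t (1 : ℝ)⟩ :=
    h3 _ _ h1
  rw [h4] at h2
  have h5 := congrArg (fun w : TangentBundle IP P => η.form w.proj w.snd) h2
  exact h5.trans (η.fundamental q _)

/-- The product rule `η((p s)') = Ad(s⁻¹) η(p') + s⁻¹ s'` for curves `p` in the bundle and `s` in
the structure group. -/
theorem Connection.form_mfderiv_act (η : Connection B) {p : ℝ → P} {s : ℝ → S} {t : ℝ}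
    (hp : MDifferentiableAt 𝓘(ℝ, ℝ) IP p t) (hs : MDifferentiableAt 𝓘(ℝ, ℝ) IS s t) :
    η.onVelocity (fun τ => B.act (p τ) (s τ)) t =
      Ad IS (s t)⁻¹ (η.onVelocity p t) + leftLogDeriv IS s t := by
  have hact : MDifferentiableAt (IP.prod IS) IP (fun x : P × S => B.act x.1 x.2) (p t, s t) :=
    B.contMDiff_act.mdifferentiable (by simp) _
  have h1 : mfderiv 𝓘(ℝ, ℝ) IP (fun τ => B.act (p τ) (s τ)) t (1 : ℝ) =
      mfderiv IP IP (fun q => B.act q (s t)) (p t) (mfderiv 𝓘(ℝ, ℝ) IP p t (1 : ℝ)) +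
      mfderiv IS IP (fun h => B.act (p t) h) (s t) (mfderiv 𝓘(ℝ, ℝ) IS s t (1 : ℝ)) := by
    have := mfderiv_comp (I' := IP.prod IS) t hact (hp.prodMk hs)
    have h2 := congrArg (fun T : ℝ →L[ℝ] EP => T (1 : ℝ)) this
    refine h2.trans ?_
    change mfderiv (IP.prod IS) IP (fun x : P × S => B.act x.1 x.2) (p t, s t)
      (mfderiv 𝓘(ℝ, ℝ) (IP.prod IS) (fun x => (p x, s x)) t (1 : ℝ)) = _
    rw [mfderiv_prod_eq_add_apply hact, hp.mfderiv_prod hs]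
    rfl
  rw [Connection.onVelocity, h1, map_add]
  congr 1
  · exact η.equivariant (s t) (p t) _
  · have hL : ContMDiff IS IS ∞ fun h : S => (s t)⁻¹ * h := contMDiff_mul_left
    have hc : MDifferentiableAt 𝓘(ℝ, ℝ) IS (fun τ => (s t)⁻¹ * s τ) t :=
      (hL.mdifferentiable (by simp) _).comp t hs
    have h2 := η.form_mfderiv_orbit (B.act (p t) (s t)) hc (inv_mul_cancel _)
    have h3 : (fun τ => B.act (B.act (p t) (s t)) ((s t)⁻¹ * s τ)) =
        fun τ => B.act (p t) (s τ) := by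
      funext τ; rw [← B.act_mul, mul_inv_cancel_left]
    have h4 : mfderiv 𝓘(ℝ, ℝ) IP (fun τ => B.act (p t) (s τ)) t (1 : ℝ) =
        mfderiv IS IP (fun h => B.act (p t) h) (s t) (mfderiv 𝓘(ℝ, ℝ) IS s t (1 : ℝ)) :=
      congrArg (fun T : ℝ →L[ℝ] EP => T (1 : ℝ))
        (mfderiv_comp (I' := IS) (g := fun h => B.act (p t) h) t (mdiff_orbit (p t) _) hs)
    rw [h3] at h2
    exact (congrArg (η.form (B.act (p t) (s t))) h4.symm).trans h2

theorem Ad_injective (s : S) : Function.Injective (Ad IS s) := by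
  have : IsManifold IS ∞ S := inferInstanceAs (IsManifold IS ∞ S)
  have h (s : S) : ContMDiff IS IS ∞ fun h : S => s * h * s⁻¹ :=
    (contMDiff_const.mul contMDiff_id).mul contMDiff_const
  have h1 := mfderiv_comp (I' := IS) (1 : S) ((h s⁻¹).mdifferentiable (by simp) (s * 1 * s⁻¹))
    ((h s).mdifferentiable (by simp) 1)
  have h2 : (fun h : S => s⁻¹ * h * s⁻¹⁻¹) ∘ (fun h : S => s * h * s⁻¹) = id := by
    funext h; simp only [Function.comp, id]; group
  rw [h2, mfderiv_id] at h1
  intro v w hvw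
  have h3 (x : ES) := congrArg (fun T : ES →L[ℝ] ES => T x) h1
  refine (h3 v).trans (Eq.trans ?_ (h3 w).symm)
  exact congrArg (mfderiv IS IS (fun h : S => s⁻¹ * h * s⁻¹⁻¹) (s * 1 * s⁻¹)) hvw

end ProductRule

/-! ### Horizontal curves and their images -/

section Horizontal

set_option linter.unusedSectionVars false

variable [IsManifold IP ∞ P] [LieGroup IS ∞ S] {B : PrincipalBundle IM IP IS M P S}
  {η η' : Connection B} {γ₁ γ₂ : ℝ → P} {c d : ℝ}

theorem IsHorizontalOn.mono (h : IsHorizontalOn η γ₁ c d) {c₁ d₁ : ℝ} (hc : c ≤ c₁)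
    (hd : d₁ ≤ d) : IsHorizontalOn η γ₁ c₁ d₁ := by
  obtain ⟨c', hc', d', hd', δ, hδ, heq, hhor⟩ := h
  have hsub : Icc c₁ d₁ ⊆ Icc c d := Icc_subset_Icc hc hd
  exact ⟨c', hc'.trans_le hc, d', hd.trans_lt hd', δ, hδ, heq.mono hsub,
    fun t ht => hhor t (hsub ht)⟩

theorem IsHorizontalOn.congr (h : IsHorizontalOn η γ₁ c d) (heq : EqOn γ₁ γ₂ (Icc c d)) :
    IsHorizontalOn η γ₂ c d := by
  obtain ⟨c', hc', d', hd', δ, hδ, heq', hhor⟩ := h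
  exact ⟨c', hc', d', hd', δ, hδ, heq.symm.trans heq', hhor⟩

theorem IsHorizontalOn.continuousOn (h : IsHorizontalOn η γ₁ c d) : ContinuousOn γ₁ (Icc c d) := by
  obtain ⟨c', hc', d', hd', δ, hδ, heq, -⟩ := h
  exact (hδ.continuousOn.mono (Icc_subset_Ioo hc' hd')).congr heq

/-- On the interior of the interval, a horizontal curve is differentiable with horizontal
velocity. -/
theorem IsHorizontalOn.onVelocity_eq_zero (h : IsHorizontalOn η γ₁ c d) {t : ℝ}
    (ht : t ∈ Ioo c d) :
    MDifferentiableAt 𝓘(ℝ, ℝ) IP γ₁ t ∧ η.onVelocity γ₁ t = 0 := by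
  obtain ⟨c', hc', d', hd', δ, hδ, heq, hhor⟩ := h
  have ht' : t ∈ Ioo c' d' := ⟨hc'.trans ht.1, ht.2.trans hd'⟩
  have hδt : MDifferentiableAt 𝓘(ℝ, ℝ) IP δ t :=
    (hδ.contMDiffAt (isOpen_Ioo.mem_nhds ht')).mdifferentiableAt (by simp)
  have hev : γ₁ =ᶠ[𝓝 t] δ := Filter.eventuallyEq_of_mem (Icc_mem_nhds ht.1 ht.2) heq
  refine ⟨hδt.congr_of_eventuallyEq hev, ?_⟩
  have h1 : tangentMap 𝓘(ℝ, ℝ) IP γ₁ ⟨t, (1 : ℝ)⟩ = tangentMap 𝓘(ℝ, ℝ) IP δ ⟨t, (1 : ℝ)⟩ := by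
    have hm : (mfderiv 𝓘(ℝ, ℝ) IP γ₁ t : ℝ →L[ℝ] EP) = mfderiv 𝓘(ℝ, ℝ) IP δ t := hev.mfderiv_eq
    have hp : ∀ (p q : P) (v w : EP), p = q → v = w →
        (⟨p, v⟩ : TangentBundle IP P) = ⟨q, w⟩ := by
      rintro p q v w rfl rfl; rfl
    exact hp _ _ _ _ hev.eq_of_nhds (congrArg (fun T : ℝ →L[ℝ] EP => T (1 : ℝ)) hm)
  exact (congrArg (fun w : TangentBundle IP P => η.form w.proj w.snd) h1).trans
    (hhor t (Ioo_subset_Icc_self ht))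

/-- Smooth maps which map horizontal vectors to horizontal ones preserve horizontal curves. -/
theorem IsHorizontalOn.comp (h : IsHorizontalOn η γ₁ c d) {f : P → P} (hf : ContMDiff IP IP ∞ f)
    (hη : ∀ (q : P) (v : TangentSpace IP q), η.form q v = 0 →
      η'.form (f q) (mfderiv IP IP f q v) = 0) :
    IsHorizontalOn η' (fun t => f (γ₁ t)) c d := by
  obtain ⟨c', hc', d', hd', δ, hδ, heq, hhor⟩ := h
  refine ⟨c', hc', d', hd', fun t => f (δ t), (hf.of_le (by simp)).comp_contMDiffOn hδ,
    fun t ht => congrArg f (heq ht), fun t ht => ?_⟩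
  have hδt : MDifferentiableAt 𝓘(ℝ, ℝ) IP δ t :=
    (hδ.contMDiffAt (isOpen_Ioo.mem_nhds (Icc_subset_Ioo hc' hd' ht))).mdifferentiableAt (by simp)
  have h1 := congrArg (fun T : ℝ →L[ℝ] EP => T (1 : ℝ))
    (mfderiv_comp (I' := IP) (g := f) t (hf.mdifferentiable (by simp) _) hδt)
  exact (congrArg (η'.form (f (δ t))) h1).trans (hη (δ t) _ (hhor t ht))

theorem IsHorizontalLift.comp {γ : Curve M} {p : P} (h : IsHorizontalLift η γ p γ₁) {f : P → P}
    (hf : ContMDiff IP IP ∞ f)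
    (hη : ∀ (q : P) (v : TangentSpace IP q), η.form q v = 0 →
      η'.form (f q) (mfderiv IP IP f q v) = 0)
    {F : M → M} (hF : ∀ q, B.proj (f q) = F (B.proj q)) :
    IsHorizontalLift η' (γ.map F) (f p) (fun t => f (γ₁ t)) := by
  obtain ⟨hproj, ha, n, τ, hτ, h0, h1, hhor⟩ := h
  refine ⟨fun t => ?_, congrArg f ha, n, τ, hτ, h0, h1, fun i => (hhor i).comp hf hη⟩
  rw [hF]
  exact congrArg F (hproj t)

/-- Right translates of horizontal vectors are horizontal. -/
theorem Connection.form_act_eq_zero (s : S) (q : P) (v : TangentSpace IP q)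
    (hv : η.form q v = 0) :
    η.form (B.act q s) (mfderiv IP IP (fun q => B.act q s) q v) = 0 := by
  rw [η.equivariant, hv, map_zero]

theorem contMDiff_act_right (s : S) : ContMDiff IP IP ∞ fun q : P => B.act q s :=
  B.contMDiff_act.comp (contMDiff_id.prodMk contMDiff_const)

end Horizontal

/-! ### Uniqueness of horizontal lifts -/

section Uniqueness

set_option linter.unusedSectionVars false

/-- A continuous curve in a manifold whose velocity vanishes in the interior of an interval is
constant. -/
theorem eqOn_of_hasMFDerivAt_zero [T2Space S] [IS.Boundaryless] [IsManifold IS 1 S] {s : ℝ → S}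
    {c d : ℝ} (hcd : c < d) (hs : ContinuousOn s (Icc c d))
    (h : ∀ t ∈ Ioo c d, HasMFDerivAt 𝓘(ℝ, ℝ) IS s t 0) : ∀ t ∈ Icc c d, s t = s c := by
  -- in a chart around `s t`, the derivative vanishes
  have hloc : ∀ t ∈ Ioo c d, ∀ᶠ τ in 𝓝 t, s τ = s t := by
    intro t ht
    have hsrc : ∀ᶠ τ in 𝓝 t, τ ∈ Ioo c d ∧ s τ ∈ (extChartAt IS (s t)).source :=
      Filter.Eventually.and (Ioo_mem_nhds ht.1 ht.2)
        ((h t ht).continuousAt.eventually (extChartAt_source_mem_nhds (s t)))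
    obtain ⟨ε, hε, hball⟩ := Metric.eventually_nhds_iff_ball.1 hsrc
    have hder : ∀ τ ∈ Metric.ball t ε,
        HasFDerivAt (fun τ => extChartAt IS (s t) (s τ)) (0 : ℝ →L[ℝ] ES) τ := by
      intro τ hτ
      have h1 : HasMFDerivAt IS 𝓘(ℝ, ES) (extChartAt IS (s t)) (s τ)
          (mfderiv IS 𝓘(ℝ, ES) (extChartAt IS (s t)) (s τ)) :=
        (mdifferentiableAt_extChartAt (by simpa using (hball τ hτ).2)).hasMFDerivAt
      have h2 := (h1.comp τ (h τ (hball τ hτ).1)).hasFDerivAt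
      have h3 : ((mfderiv IS 𝓘(ℝ, ES) (extChartAt IS (s t)) (s τ)).comp
          (0 : ℝ →L[ℝ] ES) : ℝ →L[ℝ] ES) = 0 := ContinuousLinearMap.comp_zero _
      exact h3 ▸ h2
    filter_upwards [Metric.ball_mem_nhds t hε] with τ hτ
    have hconst := (convex_ball t ε).is_const_of_fderivWithin_eq_zero (𝕜 := ℝ)
      (fun x hx => (hder x hx).differentiableAt.differentiableWithinAt)
      (fun x hx => (hder x hx).hasFDerivWithinAt.fderivWithin
        (Metric.isOpen_ball.uniqueDiffWithinAt hx)) hτ (Metric.mem_ball_self hε)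
    exact (extChartAt IS (s t)).injOn (hball τ hτ).2 (mem_extChartAt_source (s t)) hconst
  obtain ⟨m, hm⟩ := exists_between hcd
  have hIoo : EqOn s (fun _ => s m) (Ioo c d) := by
    intro t ht
    have : IsPreconnected (Ioo c d) := isPreconnected_Ioo
    have hcl : IsLocallyConstant fun x : Ioo c d => s x := by
      rw [IsLocallyConstant.iff_eventually_eq]
      intro x
      exact continuous_subtype_val.continuousAt.eventually (hloc x x.2)
    have := Subtype.preconnectedSpace this
    exact hcl.apply_eq_of_preconnectedSpace ⟨t, ht⟩ ⟨m, hm⟩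
  have hIcc : EqOn s (fun _ => s m) (Icc c d) := by
    rw [← closure_Ioo hcd.ne] at hs ⊢
    exact hIoo.of_subset_closure hs continuousOn_const subset_closure subset_rfl
  intro t ht
  exact (hIcc ht).trans (hIcc ⟨le_rfl, hcd.le⟩).symm

variable [IsManifold IP ∞ P] [LieGroup IS ∞ S] [IS.Boundaryless] [T2Space S]
  {B : PrincipalBundle IM IP IS M P S} {η : Connection B}

/-- The structure group element relating two curves in the bundle which have the same projection is
as regular as the curves, since it may be computed in a local trivialization. -/
theorem exists_eventually_diff_eq {γ₁ γ₂ : ℝ → P} {A : Set ℝ}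
    (hproj : ∀ t ∈ A, B.proj (γ₁ t) = B.proj (γ₂ t)) (h₁ : ContinuousOn γ₁ A)
    (h₂ : ContinuousOn γ₂ A) {t : ℝ} (ht : t ∈ A) :
    ∃ (W : Set P) (σ : P → S), IsOpen W ∧ ContMDiffOn IP IS ∞ σ W ∧ γ₁ t ∈ W ∧ γ₂ t ∈ W ∧
      ∀ᶠ τ in 𝓝[A] t, γ₁ τ ∈ W ∧ γ₂ τ ∈ W ∧ B.diff (γ₁ τ) (γ₂ τ) = (σ (γ₁ τ))⁻¹ * σ (γ₂ τ) := by
  obtain ⟨U, hU, htU, e, hsrc, -, hsm, -, hact⟩ := B.locally_trivial (B.proj (γ₁ t))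
  have m1 : γ₁ t ∈ e.source := by rw [hsrc]; exact htU
  have m2 : γ₂ t ∈ e.source := by rw [hsrc, mem_preimage, ← hproj t ht]; exact htU
  refine ⟨e.source, fun p => (e p).2, e.open_source, fun p hp =>
    contMDiffAt_snd.comp_contMDiffWithinAt p (hsm p hp), m1, m2, ?_⟩
  filter_upwards [(h₁ t ht).eventually (e.open_source.mem_nhds m1),
    (h₂ t ht).eventually (e.open_source.mem_nhds m2), self_mem_nhdsWithin] with τ w1 w2 hτ
  refine ⟨w1, w2, ?_⟩
  have h := hact _ w1 (B.diff (γ₁ τ) (γ₂ τ))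
  rw [PrincipalBundle.act_diff (hproj τ hτ)] at h
  rw [h, inv_mul_cancel_left]

/-- Two horizontal curves with the same projection agree if their initial points agree: by the
product rule, the curve in the structure group which relates them has vanishing velocity. -/
theorem IsHorizontalOn.eqOn {γ₁ γ₂ : ℝ → P} {c d : ℝ} (hcd : c < d) (h₁ : IsHorizontalOn η γ₁ c d)
    (h₂ : IsHorizontalOn η γ₂ c d) (hproj : ∀ t ∈ Icc c d, B.proj (γ₁ t) = B.proj (γ₂ t))
    (hc : γ₁ c = γ₂ c) : EqOn γ₁ γ₂ (Icc c d) := by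
  have : IsManifold IS ∞ S := inferInstanceAs (IsManifold IS ∞ S)
  have : IsManifold IS 1 S := IsManifold.of_le (n := ∞) (by simp)
  have : IsTopologicalGroup S := topologicalGroup_of_lieGroup IS ∞
  let s : ℝ → S := fun t => B.diff (γ₁ t) (γ₂ t)
  have hs (t : ℝ) (ht : t ∈ Icc c d) : B.act (γ₁ t) (s t) = γ₂ t :=
    PrincipalBundle.act_diff (hproj t ht)
  have hcont : ContinuousOn s (Icc c d) := by
    intro t ht
    obtain ⟨W, σ, hW, hσ, m1, m2, hev⟩ :=
      exists_eventually_diff_eq hproj h₁.continuousOn h₂.continuousOn ht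
    have k1 := ((hσ.continuousOn.continuousAt (hW.mem_nhds m1)).comp_continuousWithinAt
      (h₁.continuousOn t ht)).inv
    have k2 := (hσ.continuousOn.continuousAt (hW.mem_nhds m2)).comp_continuousWithinAt
      (h₂.continuousOn t ht)
    exact (k1.mul k2).congr_of_eventuallyEq (hev.mono fun τ h => h.2.2)
      (hev.self_of_nhdsWithin ht).2.2
  have hder : ∀ t ∈ Ioo c d, HasMFDerivAt 𝓘(ℝ, ℝ) IS s t 0 := by
    intro t ht
    have htI := Ioo_subset_Icc_self ht
    obtain ⟨W, σ, hW, hσ, m1, m2, hev⟩ :=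
      exists_eventually_diff_eq hproj h₁.continuousOn h₂.continuousOn htI
    rw [nhdsWithin_eq_nhds.2 (Icc_mem_nhds ht.1 ht.2)] at hev
    obtain ⟨d1, z1⟩ := h₁.onVelocity_eq_zero ht
    obtain ⟨d2, z2⟩ := h₂.onVelocity_eq_zero ht
    have hσd {p : P} (hp : p ∈ W) : MDifferentiableAt IP IS σ p :=
      (hσ.contMDiffAt (hW.mem_nhds hp)).mdifferentiableAt (by simp)
    have hmul (a : S) : MDifferentiable IS IS fun h : S => a * h :=
      contMDiff_mul_left.mdifferentiable (n := ∞) (by simp)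
    have hsd : MDifferentiableAt 𝓘(ℝ, ℝ) IS s t := by
      have k1 := (hσd m1).comp t d1
      have k2 := (hσd m2).comp t d2
      have kinv : MDifferentiable IS IS fun h : S => h⁻¹ :=
        (contMDiff_inv IS ∞).mdifferentiable (by simp)
      have kmul : MDifferentiable (IS.prod IS) IS fun h : S × S => h.1 * h.2 :=
        (contMDiff_mul IS ∞).mdifferentiable (by simp)
      have k3 := (kmul _).comp t (((kinv _).comp t k1).prodMk k2)
      exact k3.congr_of_eventuallyEq (hev.mono fun τ h => h.2.2)
    have hprod := η.form_mfderiv_act d1 hsd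
    have hγ : (fun τ => B.act (γ₁ τ) (s τ)) =ᶠ[𝓝 t] γ₂ :=
      Filter.eventuallyEq_of_mem (Icc_mem_nhds ht.1 ht.2) hs
    have hhor : IsHorizontalOn η (fun τ => B.act (γ₁ τ) (s τ)) c d :=
      h₂.congr fun τ hτ => (hs τ hτ).symm
    rw [(hhor.onVelocity_eq_zero ht).2, z1, map_zero, zero_add] at hprod
    have k : HasMFDerivAt 𝓘(ℝ, ℝ) IS (fun τ => (s t)⁻¹ * s τ) t (0 : ℝ →L[ℝ] ES) := by
      have k4 := ((hmul (s t)⁻¹ (s t)).comp t hsd).hasMFDerivAt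
      have k5 : (mfderiv 𝓘(ℝ, ℝ) IS ((fun h : S => (s t)⁻¹ * h) ∘ s) t : ℝ →L[ℝ] ES) = 0 :=
        ContinuousLinearMap.ext_ring hprod.symm
      exact k5 ▸ k4
    have k6 := ((hmul (s t) ((s t)⁻¹ * s t)).hasMFDerivAt).comp t k
    have k7 : ((fun h : S => s t * h) ∘ fun τ => (s t)⁻¹ * s τ) = s := by
      funext τ; exact mul_inv_cancel_left _ _
    rw [k7] at k6
    have k8 : ((mfderiv IS IS (fun h : S => s t * h) ((s t)⁻¹ * s t)).comp
          (0 : ℝ →L[ℝ] ES) : ℝ →L[ℝ] ES) = 0 := ContinuousLinearMap.comp_zero _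
    exact k8 ▸ k6
  have hsc : s c = 1 := PrincipalBundle.act_injective (γ₁ c) (by
    rw [hs c ⟨le_rfl, hcd.le⟩, B.act_one, hc])
  intro t ht
  have h1 := hs t ht
  rwa [eqOn_of_hasMFDerivAt_zero hcd hcont hder t ht, hsc, B.act_one] at h1

theorem continuousOn_of_reflTransGen {γ' : ℝ → P} {a b : ℝ}
    (h : Relation.ReflTransGen (fun c d => c < d ∧ IsHorizontalOn η γ' c d) a b) :
    a ≤ b ∧ ContinuousOn γ' (Icc a b) := by
  induction h with
  | refl => exact ⟨le_rfl, by rw [Icc_self]; exact continuousOn_singleton _ _⟩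
  | tail _ h ih =>
    refine ⟨ih.1.trans h.1.le, ?_⟩
    rw [← Icc_union_Icc_eq_Icc ih.1 h.1.le]
    exact ih.2.union_of_isClosed h.2.continuousOn isClosed_Icc isClosed_Icc

/-- A piecewise horizontal curve is horizontal on some interval to the right of each parameter. -/
theorem exists_isHorizontalOn_right {γ' : ℝ → P} {a b : ℝ}
    (h : Relation.ReflTransGen (fun c d => c < d ∧ IsHorizontalOn η γ' c d) a b) {t : ℝ}
    (ht : t ∈ Ico a b) : ∃ d > t, d ≤ b ∧ IsHorizontalOn η γ' t d := by
  induction h with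
  | refl => exact absurd ht (by simp)
  | @tail c d _ h ih =>
    rcases lt_or_ge t c with htc | htc
    · obtain ⟨d', h1, h2, h3⟩ := ih ⟨ht.1, htc⟩
      exact ⟨d', h1, h2.trans h.1.le, h3⟩
    · exact ⟨d, ht.2, le_rfl, h.2.mono htc le_rfl⟩

/-- Horizontal lifts are determined by their initial points. -/
theorem IsHorizontalLift.eqOn [T2Space P] {γ : Curve M} {p : P} {γ₁ γ₂ : ℝ → P}
    (h₁ : IsHorizontalLift η γ p γ₁) (h₂ : IsHorizontalLift η γ p γ₂) :
    EqOn γ₁ γ₂ (Icc γ.a γ.b) := by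
  obtain ⟨p1, a1, q1⟩ := h₁
  obtain ⟨p2, a2, q2⟩ := h₂
  rw [exists_partition_iff_reflTransGen] at q1 q2
  have hclosed : IsClosed ({t | γ₁ t = γ₂ t} ∩ Icc γ.a γ.b) := by
    rw [inter_comm]
    exact ((continuousOn_of_reflTransGen q1).2.prodMk (continuousOn_of_reflTransGen q2).2
      ).preimage_isClosed_of_isClosed isClosed_Icc isClosed_diagonal
  refine hclosed.Icc_subset_of_forall_exists_gt (a1.trans a2.symm) ?_
  rintro x ⟨hx, hxI⟩ y hy
  obtain ⟨d1, l1, b1, H1⟩ := exists_isHorizontalOn_right q1 hxI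
  obtain ⟨d2, l2, b2, H2⟩ := exists_isHorizontalOn_right q2 hxI
  have hlt : x < min (min d1 d2) y := lt_min (lt_min l1 l2) hy
  have hle1 : min (min d1 d2) y ≤ d1 := (min_le_left _ _).trans (min_le_left _ _)
  have hle2 : min (min d1 d2) y ≤ d2 := (min_le_left _ _).trans (min_le_right _ _)
  refine ⟨min (min d1 d2) y, ?_, hlt, min_le_right _ _⟩
  refine (H1.mono le_rfl hle1).eqOn hlt (H2.mono le_rfl hle2) (fun t ht => ?_) hx
    ⟨hlt.le, le_rfl⟩
  have htI : t ∈ Icc γ.a γ.b := ⟨hxI.1.trans ht.1, ht.2.trans (hle1.trans b1)⟩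
  exact (p1 ⟨t, htI⟩).trans (p2 ⟨t, htI⟩).symm

end Uniqueness

/-! ### Existence of horizontal lifts -/

section Existence

set_option linter.unusedSectionVars false

variable [IsManifold IP ∞ P] [CompleteSpace ES] [IS.Boundaryless] [LieGroup IS ∞ S]
  {B : PrincipalBundle IM IP IS M P S} (η : Connection B)

/-- `C^1`-curves in the base lift horizontally on a neighbourhood of each parameter. For a local
section `p` along the curve, the lift is `p u⁻¹`, where `u` is a curve in the structure group whose
left logarithmic derivative is `η(p')`; it is horizontal by the product rule for
`p = (p u⁻¹) u`. -/
theorem exists_local_horizontal_lift {δ : ℝ → M} {s : Set ℝ} (hs : IsOpen s)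
    (hδ : ContMDiffOn 𝓘(ℝ, ℝ) IM 1 δ s) {t₀ : ℝ} (ht₀ : t₀ ∈ s) :
    ∃ ε > 0, Ioo (t₀ - ε) (t₀ + ε) ⊆ s ∧ ∃ q : ℝ → P,
      ContMDiffOn 𝓘(ℝ, ℝ) IP 1 q (Ioo (t₀ - ε) (t₀ + ε)) ∧
      ∀ t ∈ Ioo (t₀ - ε) (t₀ + ε), B.proj (q t) = δ t ∧ η.onVelocity q t = 0 := by
  have : IsManifold IP 1 P := IsManifold.of_le (n := ∞) (by simp)
  obtain ⟨U, hU, htU, e, hsrc, htgt, -, hsm, hact⟩ := B.locally_trivial (δ t₀)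
  let s' := s ∩ δ ⁻¹' U
  have hs' : IsOpen s' := hδ.continuousOn.isOpen_inter_preimage hs hU
  let p : ℝ → P := fun t => e.symm (δ t, 1)
  have hmem (t : ℝ) (ht : t ∈ s') : (δ t, (1 : S)) ∈ e.target := by
    rw [htgt]; exact ⟨ht.2, mem_univ _⟩
  have hpC : ContMDiffOn 𝓘(ℝ, ℝ) IP 1 p s' :=
    (hsm.of_le (by simp)).comp ((hδ.mono inter_subset_left).prodMk contMDiffOn_const) hmem
  have hpδ (t : ℝ) (ht : t ∈ s') : B.proj (p t) = δ t := by
    rw [← PrincipalBundle.fst_trivialization hact (e.map_target (hmem t ht)),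
      e.right_inv (hmem t ht)]
  have hA : ContinuousOn (η.onVelocity p) s' := by
    have h1 := hpC.continuousOn_tangentMapWithin le_rfl hs'.uniqueMDiffOn
    have h2 : ContinuousOn (fun t : ℝ => (⟨t, (1 : ℝ)⟩ : TangentBundle 𝓘(ℝ, ℝ) ℝ)) s' :=
      ((tangentBundleModelSpaceHomeomorph 𝓘(ℝ, ℝ)).symm.continuous.comp
        (continuous_id.prodMk continuous_const)).continuousOn
    have h3 := η.smooth.continuous.comp_continuousOn (h1.comp h2 fun t ht => ht)
    refine h3.congr fun t ht => ?_
    have h4 : (mfderivWithin 𝓘(ℝ, ℝ) IP p s' t : ℝ →L[ℝ] EP) = mfderiv 𝓘(ℝ, ℝ) IP p t :=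
      mfderivWithin_of_isOpen hs' ht
    exact congrArg (fun T : ℝ →L[ℝ] EP => η.form (p t) (T (1 : ℝ))) h4.symm
  obtain ⟨u, -, ε, hε, hεs, huC, hu⟩ := exists_curve_leftLogDeriv_eq IS hs' hA ⟨ht₀, htU⟩
  have hqC : ContMDiffOn 𝓘(ℝ, ℝ) IP 1 (fun t => B.act (p t) (u t)⁻¹) (Ioo (t₀ - ε) (t₀ + ε)) := by
    have hinv : ContMDiffOn 𝓘(ℝ, ℝ) IS 1 (fun t => (u t)⁻¹) (Ioo (t₀ - ε) (t₀ + ε)) :=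
      ((contMDiff_inv IS ∞).of_le (by simp)).comp_contMDiffOn huC
    exact (B.contMDiff_act.of_le (by simp)).comp_contMDiffOn ((hpC.mono hεs).prodMk hinv)
  refine ⟨ε, hε, hεs.trans inter_subset_left, _, hqC, fun t ht => ⟨?_, ?_⟩⟩
  · rw [B.proj_act, hpδ t (hεs ht)]
  · have hq := (hqC.contMDiffAt (isOpen_Ioo.mem_nhds ht)).mdifferentiableAt (by simp)
    have hud := (huC.contMDiffAt (isOpen_Ioo.mem_nhds ht)).mdifferentiableAt (by simp)
    have h := η.form_mfderiv_act hq hud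
    simp only [PrincipalBundle.act_act_inv] at h
    rw [hu t ht] at h
    have h0 := right_eq_add.1 h
    exact Ad_injective (IS := IS) (u t)⁻¹ (h0.trans (map_zero _).symm)

/-- Curves of class `C^1` on an interval admit a partition of the interval such that horizontal
lifts with arbitrary initial points exist over each of its parts. -/
theorem IsOfClassOn.reflTransGen_lift {γ : ℝ → M} {c d : ℝ} (hcd : c ≤ d)
    (h : IsOfClassOn IM 1 γ c d) :
    Relation.ReflTransGen (fun c d => c < d ∧ ∀ p, B.proj p = γ c → ∃ γ' : ℝ → P,
      γ' c = p ∧ (∀ t ∈ Icc c d, B.proj (γ' t) = γ t) ∧ IsHorizontalOn η γ' c d) c d := by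
  obtain ⟨c', hc', d', hd', δ, hδ, heq⟩ := h
  have hsub : Icc c d ⊆ Ioo c' d' := Icc_subset_Ioo hc' hd'
  choose ε hε hεs q hqC hq using fun (t : ℝ) (ht : t ∈ Ioo c' d') =>
    exists_local_horizontal_lift η isOpen_Ioo hδ ht
  let O : Icc c d → Set (Icc c d) := fun x =>
    Subtype.val ⁻¹' Ioo ((x : ℝ) - ε x (hsub x.2)) ((x : ℝ) + ε x (hsub x.2))
  obtain ⟨τ, h0, hmono, ⟨m, hm⟩, hτ⟩ := exists_monotone_Icc_subset_open_cover_Icc hcd (c := O)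
    (fun x => isOpen_Ioo.preimage continuous_subtype_val) (fun x _ => mem_iUnion.2
      ⟨x, by have := hε x (hsub x.2); constructor <;> linarith⟩)
  have step (n : ℕ) : Relation.ReflTransGen (fun c d => c < d ∧ ∀ p, B.proj p = γ c →
      ∃ γ' : ℝ → P, γ' c = p ∧ (∀ t ∈ Icc c d, B.proj (γ' t) = γ t) ∧ IsHorizontalOn η γ' c d)
      c (τ n) := by
    induction n with
    | zero => rw [h0]
    | succ n ih =>
      rcases (hmono n.le_succ).eq_or_lt with hn | hn
      · rwa [← hn]
      refine ih.tail ⟨hn, fun p hp => ?_⟩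
      obtain ⟨x, hx⟩ := hτ n
      have hxI := hsub x.2
      have hpart : Icc (τ n : ℝ) (τ (n + 1)) ⊆ Ioo (x - ε x hxI) (x + ε x hxI) := fun t ht =>
        hx (show (⟨t, (τ n).2.1.trans ht.1, ht.2.trans (τ (n + 1)).2.2⟩ : Icc c d) ∈ _ from ht)
      have hγq : ∀ t ∈ Icc (τ n : ℝ) (τ (n + 1)), B.proj (q x hxI t) = γ t := fun t ht => by
        rw [(hq x hxI t (hpart ht)).1, heq ⟨(τ n).2.1.trans ht.1, ht.2.trans (τ (n + 1)).2.2⟩]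
      have hl := hpart (left_mem_Icc.2 hn.le)
      have hr := hpart (right_mem_Icc.2 hn.le)
      have hhor : IsHorizontalOn η (q x hxI) (τ n) (τ (n + 1)) :=
        ⟨_, hl.1, _, hr.2, q x hxI, hqC x hxI, fun _ _ => rfl,
          fun t ht => (hq x hxI t (hpart ht)).2⟩
      -- a right translate of the local lift has the prescribed initial point
      have hp' : B.proj (q x hxI (τ n)) = B.proj p := by rw [hγq _ (left_mem_Icc.2 hn.le), hp]
      exact ⟨fun t => B.act (q x hxI t) (B.diff (q x hxI (τ n)) p), PrincipalBundle.act_diff hp',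
        fun t ht => by rw [B.proj_act, hγq t ht],
        hhor.comp (contMDiff_act_right _) (Connection.form_act_eq_zero _)⟩
  have := step m
  rwa [hm m le_rfl] at this

/-- A change of the curve beyond the end point does not affect piecewise horizontality. -/
theorem reflTransGen_isHorizontalOn_congr {η : Connection B} {γ₁ γ₂ : ℝ → P} {a b : ℝ}
    (h : Relation.ReflTransGen (fun c d => c < d ∧ IsHorizontalOn η γ₁ c d) a b)
    (heq : EqOn γ₁ γ₂ (Iic b)) :
    Relation.ReflTransGen (fun c d => c < d ∧ IsHorizontalOn η γ₂ c d) a b := by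
  induction h with
  | refl => exact .refl
  | tail _ h ih =>
    exact (ih (heq.mono (Iic_subset_Iic.2 h.1.le))).tail
      ⟨h.1, h.2.congr (heq.mono fun t ht => ht.2)⟩

/-- Horizontal lifts of piecewise `C^1`-curves exist. -/
theorem exists_isHorizontalLift {k : ℕ∞ω} (hk : 1 ≤ k) {γ : Curve M} (hγ : IsPath IM k γ) {p : P}
    (hp : B.proj p = γ.val γ.a) : ∃ γ', IsHorizontalLift η γ p γ' := by
  have hγ' := (exists_partition_iff_reflTransGen (IsOfClassOn IM k γ.val) γ.a γ.b).1 hγ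
  have hchain : Relation.ReflTransGen (fun c d => c < d ∧ ∀ p, B.proj p = γ.val c →
      ∃ γ' : ℝ → P, γ' c = p ∧ (∀ t ∈ Icc c d, B.proj (γ' t) = γ.val t) ∧
      IsHorizontalOn η γ' c d) γ.a γ.b := by
    generalize γ.b = b at hγ'
    induction hγ' with
    | refl => exact .refl
    | tail _ h ih =>
      obtain ⟨hlt, c', hc', d', hd', δ, hδ, heq⟩ := h
      exact ih.trans (IsOfClassOn.reflTransGen_lift η hlt.le
        ⟨c', hc', d', hd', δ, hδ.of_le hk, heq⟩)
  have key : ∀ b, Relation.ReflTransGen (fun c d => c < d ∧ ∀ p, B.proj p = γ.val c →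
      ∃ γ' : ℝ → P, γ' c = p ∧ (∀ t ∈ Icc c d, B.proj (γ' t) = γ.val t) ∧
      IsHorizontalOn η γ' c d) γ.a b → γ.a ≤ b ∧ ∃ γ' : ℝ → P, γ' γ.a = p ∧
        (∀ t ∈ Icc γ.a b, B.proj (γ' t) = γ.val t) ∧
        Relation.ReflTransGen (fun c d => c < d ∧ IsHorizontalOn η γ' c d) γ.a b := by
    intro b hb
    induction hb with
    | refl => exact ⟨le_rfl, fun _ => p, rfl, fun t ht => by
        rw [Icc_self] at ht; rw [ht, hp], .refl⟩
    | @tail c d _ h ih =>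
      obtain ⟨hac, γ₁, h0, hproj, hgen⟩ := ih
      obtain ⟨γ₂, g0, gproj, ghor⟩ := h.2 (γ₁ c) (hproj c ⟨hac, le_rfl⟩)
      let γ₃ : ℝ → P := fun t => if t ≤ c then γ₁ t else γ₂ t
      have e₁ : EqOn γ₁ γ₃ (Iic c) := fun t ht => (if_pos ht).symm
      have e₂ : EqOn γ₂ γ₃ (Icc c d) := by
        intro t ht
        rcases ht.1.eq_or_lt with rfl | hlt
        · rw [g0]; exact (if_pos le_rfl).symm
        · exact (if_neg hlt.not_ge).symm
      refine ⟨hac.trans h.1.le, γ₃, (e₁ hac).symm.trans h0, fun t ht => ?_,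
        (reflTransGen_isHorizontalOn_congr hgen e₁).tail ⟨h.1, ghor.congr e₂⟩⟩
      rcases le_total t c with htc | htc
      · rw [← e₁ htc, hproj t ⟨ht.1, htc⟩]
      · rw [← e₂ ⟨htc, ht.2⟩, gproj t ⟨htc, ht.2⟩]
  obtain ⟨-, γ', h0, hproj, hgen⟩ := key γ.b hchain
  refine ⟨γ', fun t => ?_, h0, (exists_partition_iff_reflTransGen _ _ _).2 hgen⟩
  rw [hproj t t.2]
  exact IccExtend_of_mem _ _ t.2

end Existence

/-! ### Parallel transport and holonomies -/

section Transport

set_option linter.unusedSectionVars false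

variable [IsManifold IP ∞ P] [T2Space P] [CompleteSpace ES] [IS.Boundaryless] [LieGroup IS ∞ S]
  [T2Space S] {B : PrincipalBundle IM IP IS M P S} {η : Connection B} {γ : Curve M}

theorem IsHorizontalLift.transport_eq {p : P} {γ' : ℝ → P} (h : IsHorizontalLift η γ p γ') :
    transport η γ p = γ' γ.b := by
  have hex : ∃ γ', IsHorizontalLift η γ p γ' := ⟨γ', h⟩
  rw [transport, dif_pos hex]
  exact hex.choose_spec.eqOn h ⟨γ.lt.le, le_rfl⟩

theorem IsHorizontalLift.proj_end {p : P} {γ' : ℝ → P} (h : IsHorizontalLift η γ p γ') :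
    B.proj (γ' γ.b) = γ.val γ.b :=
  (h.1 ⟨γ.b, γ.lt.le, le_rfl⟩).trans (IccExtend_of_mem _ _ ⟨γ.lt.le, le_rfl⟩).symm

variable {k : ℕ∞ω}

theorem proj_transport (hk : 1 ≤ k) (hγ : IsPath IM k γ) {p : P} (hp : B.proj p = γ.val γ.a) :
    B.proj (transport η γ p) = γ.val γ.b := by
  obtain ⟨γ', h⟩ := exists_isHorizontalLift η hk hγ hp
  rw [h.transport_eq, h.proj_end]

/-- Parallel transport commutes with the action of the structure group. -/
theorem transport_act (hk : 1 ≤ k) (hγ : IsPath IM k γ) {p : P} (hp : B.proj p = γ.val γ.a)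
    (s : S) :
    transport η γ (B.act p s) = B.act (transport η γ p) s := by
  obtain ⟨γ', h⟩ := exists_isHorizontalLift η hk hγ hp
  have h' : IsHorizontalLift η γ (B.act p s) (fun t => B.act (γ' t) s) :=
    h.comp (F := id) (contMDiff_act_right s) (Connection.form_act_eq_zero s)
      (fun q => B.proj_act q s)
  rw [h.transport_eq, h'.transport_eq]

variable [MulAction G P] [ContMDiffSMul IG IP ∞ G P] (hG : B.IsAutomorphismGroup G)

/-- Parallel transport along `γ` with respect to the connection `φ(g, η)` is conjugate, under `g`,
to parallel transport along `g⁻¹ γ` with respect to `η`. -/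
theorem transport_phi (hk : 1 ≤ k) (hγ : IsPath IM k γ) {p : P} (hp : B.proj p = γ.val γ.a)
    (g : G) :
    transport (phi IG hG g η) γ p =
      g • transport η (γ.map (B.induced g⁻¹)) (g⁻¹ • p) := by
  obtain ⟨γ', h⟩ := exists_isHorizontalLift (phi IG hG g η) hk hγ hp
  have h' : IsHorizontalLift η (γ.map (B.induced g⁻¹)) (g⁻¹ • p) (fun t => g⁻¹ • γ' t) :=
    h.comp (contMDiff_translation (IG := IG) g⁻¹) (fun q v hv => hv)
      (PrincipalBundle.proj_smul hG g⁻¹)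
  rw [h.transport_eq, h'.transport_eq]
  exact (smul_inv_smul g (γ' γ.b)).symm

/-- The holonomy along `γ` with respect to `φ(g, η)` differs from the holonomy along `g⁻¹ γ` with
respect to `η` by factors which do not depend on `η`. -/
theorem exists_holonomy_phi_eq (hk : 1 ≤ k) {ν : M → P} (hν : ∀ m, B.proj (ν m) = m) (g : G)
    (hγ : IsPath IM k γ) (hγg : IsPath IM k (γ.map (B.induced g⁻¹))) :
    ∃ s₁ s₂ : S, ∀ η : Connection B, holonomy ν γ (phi IG hG g η) =
      s₂ * holonomy ν (γ.map (B.induced g⁻¹)) η * s₁ := by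
  let x := (γ.map (B.induced g⁻¹)).val γ.a
  let y := (γ.map (B.induced g⁻¹)).val γ.b
  have h1 : B.proj (ν x) = B.proj (g⁻¹ • ν (γ.val γ.a)) := by
    rw [hν, PrincipalBundle.proj_smul hG, hν]; rfl
  have h2 : B.proj (ν (γ.val γ.b)) = B.proj (g • ν y) := by
    have h3 : B.proj (g⁻¹ • ν (γ.val γ.b)) = B.proj (ν y) := by
      rw [hν, PrincipalBundle.proj_smul hG, hν]; rfl
    have h4 := congrArg (B.induced g) h3
    rwa [← PrincipalBundle.proj_smul hG, ← PrincipalBundle.proj_smul hG, smul_inv_smul] at h4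
  refine ⟨B.diff (ν x) (g⁻¹ • ν (γ.val γ.a)), B.diff (ν (γ.val γ.b)) (g • ν y), fun η => ?_⟩
  have h5 : B.act (ν y) (holonomy ν (γ.map (B.induced g⁻¹)) η) =
      transport η (γ.map (B.induced g⁻¹)) (ν x) := by
    refine PrincipalBundle.act_diff ?_
    rw [proj_transport hk hγg (hν _), hν]
    rfl
  have h6 : transport (phi IG hG g η) γ (ν (γ.val γ.a)) = B.act (ν (γ.val γ.b))
      (B.diff (ν (γ.val γ.b)) (g • ν y) * holonomy ν (γ.map (B.induced g⁻¹)) η *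
        B.diff (ν x) (g⁻¹ • ν (γ.val γ.a))) := by
    rw [transport_phi hG hk hγ (hν _), ← PrincipalBundle.act_diff h1,
      transport_act hk hγg (hν x), ← h5, hG, hG, B.act_mul, B.act_mul,
      PrincipalBundle.act_diff h2]
    -- restore `g⁻¹ ν(γ(a))`, which has also been replaced inside of the factor `s₁`
    rw [PrincipalBundle.act_diff h1]
  rw [holonomy, h6, PrincipalBundle.diff_act]

end Transport

/-! ### The action on cylindrical functions -/

section CylAction

set_option linter.unusedSectionVars false

variable [IsManifold IP ∞ P] {B : PrincipalBundle IM IP IS M P S}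
  [MulAction G P] [ContMDiffSMul IG IP ∞ G P] (hG : B.IsAutomorphismGroup G)

theorem phi_one (η : Connection B) : phi IG hG 1 η = η := by
  have h (p : P) : tangentMap IP IP (fun q : P => (1 : G)⁻¹ • q) = id := by
    have : (fun q : P => (1 : G)⁻¹ • q) = id := by funext q; simp
    rw [this, tangentMap_id]
  refine Connection.ext (funext fun p => ContinuousLinearMap.ext fun v => ?_)
  exact congrArg (fun T : TangentBundle IP P → TangentBundle IP P =>
    η.form (T ⟨p, v⟩).proj (T ⟨p, v⟩).snd) (h p)

theorem phi_mul (g h : G) (η : Connection B) :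
    phi IG hG (g * h) η = phi IG hG g (phi IG hG h η) := by
  have hd (g : G) : MDifferentiable IP IP fun q : P => g⁻¹ • q :=
    (contMDiff_translation (IG := IG) g⁻¹).mdifferentiable (by simp)
  have key (v : TangentBundle IP P) : tangentMap IP IP (fun q : P => (g * h)⁻¹ • q) v =
      tangentMap IP IP (fun q : P => h⁻¹ • q) (tangentMap IP IP (fun q : P => g⁻¹ • q) v) := by
    rw [← tangentMap_comp_at _ (hd h _) (hd g _)]
    congr 1
    funext q
    simp [mul_smul]
  refine Connection.ext (funext fun p => ContinuousLinearMap.ext fun v => ?_)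
  exact congrArg (fun w : TangentBundle IP P => η.form w.proj w.snd) (key ⟨p, v⟩)

variable [CompactSpace S] {ν : M → P} {Paths : Set (Curve M)}

/-- A left action with continuous translations which extends `φ` is given by `χ ↦ χ ∘ φ_g^*`, since
the connections are dense in the generalized connections. -/
theorem IsExtendedAction.eq_specAction
    (h : ∀ g : G, ∀ f ∈ Cyl B ν Paths, pullback (phi IG hG g) f ∈ Cyl B ν Paths)
    {Ψ : G → GenConnection B ν Paths → GenConnection B ν Paths}
    (hΨ : IsExtendedAction IG hG ν Paths Ψ) : Ψ = specAction IG hG ν Paths h :=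
  funext fun g => (denseRange_iota (Cyl B ν Paths)).equalizer (hΨ.continuous_translation g)
    (continuous_specMap _ _ _ _) (funext fun η => hΨ.extends_phi g η)

theorem isExtendedAction_specAction
    (h : ∀ g : G, ∀ f ∈ Cyl B ν Paths, pullback (phi IG hG g) f ∈ Cyl B ν Paths) :
    IsExtendedAction IG hG ν Paths (specAction IG hG ν Paths h) where
  one χ := by
    refine Subtype.ext (ContinuousLinearMap.ext fun f => ?_)
    refine congrArg χ (Subtype.ext (BoundedContinuousFunction.ext fun η => ?_))
    exact congrArg (f : BoundedContinuousFunction (Connection B) ℂ) (phi_one (IG := IG) hG η)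
  mul g g' χ := by
    refine Subtype.ext (ContinuousLinearMap.ext fun f => ?_)
    refine congrArg χ (Subtype.ext (BoundedContinuousFunction.ext fun η => ?_))
    exact congrArg (f : BoundedContinuousFunction (Connection B) ℂ) (phi_mul (IG := IG) hG g g' η)
  continuous_translation g := continuous_specMap _ _ _ _
  extends_phi _ _ := rfl

theorem isClosed_fixedPoints_specAction
    (h : ∀ g : G, ∀ f ∈ Cyl B ν Paths, pullback (phi IG hG g) f ∈ Cyl B ν Paths) :
    IsClosed {χ | ∀ g : G, specAction IG hG ν Paths h g χ = χ} := by
  simp only [Set.ofPred_forall]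
  exact isClosed_iInter fun g => isClosed_eq (continuous_specMap _ _ _ _) continuous_id

theorem closure_iota_invariantConnections_subset
    (h : ∀ g : G, ∀ f ∈ Cyl B ν Paths, pullback (phi IG hG g) f ∈ Cyl B ν Paths) :
    closure (iota (Cyl B ν Paths) '' invariantConnections IG hG) ⊆
      {χ | ∀ g : G, specAction IG hG ν Paths h g χ = χ} := by
  refine closure_minimal ?_ (isClosed_fixedPoints_specAction hG h)
  rintro _ ⟨η, hη, rfl⟩ g
  exact congrArg (iota (Cyl B ν Paths)) (hη g)

variable [T2Space P] [CompleteSpace ES] [IS.Boundaryless] [LieGroup IS ∞ S] [T2Space S]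

/-- The translate of a matrix coefficient of the holonomy along `γ` is a linear combination of
matrix coefficients of the holonomy along `g⁻¹ γ`. -/
theorem pullback_generator_mem {k : ℕ∞ω} (hk : 1 ≤ k) (hν : ∀ m, B.proj (ν m) = m)
    (hPaths : ∀ γ ∈ Paths, IsPath IM k γ) (hinv : B.IsInvariant G Paths) (g : G)
    {f : BoundedContinuousFunction (Connection B) ℂ} (hf : f ∈ generators B ν Paths) :
    pullback (phi IG hG g) f ∈ StarAlgebra.adjoin ℂ (generators B ν Paths) := by
  obtain ⟨n, ρ, i, j, γ, hγ, rfl⟩ := hf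
  have hγg := hinv g⁻¹ γ hγ
  obtain ⟨s₁, s₂, hs⟩ := exists_holonomy_phi_eq (IG := IG) hG hk hν g (hPaths γ hγ) (hPaths _ hγg)
  have heq : pullback (phi IG hG g) (generator ρ i j ν γ) =
      ∑ b, ∑ a, (ρ.toHom s₂ i a * ρ.toHom s₁ b j) •
        generator ρ a b ν (γ.map (B.induced g⁻¹)) := by
    refine BoundedContinuousFunction.ext fun η => ?_
    rw [pullback_apply, generator_apply, hs, map_mul, map_mul, Matrix.mul_apply]
    simp only [Matrix.mul_apply, BoundedContinuousFunction.sum_apply,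
      BoundedContinuousFunction.smul_apply, generator_apply, Finset.sum_mul, smul_eq_mul]
    exact Finset.sum_congr rfl fun b _ => Finset.sum_congr rfl fun a _ => by ring
  rw [heq]
  refine sum_mem fun b _ => sum_mem fun a _ => SMulMemClass.smul_mem _ ?_
  exact StarAlgebra.subset_adjoin ℂ _ ⟨n, ρ, a, b, _, hγg, rfl⟩

theorem pullback_mem_Cyl {k : ℕ∞ω} (hk : 1 ≤ k) (hν : ∀ m, B.proj (ν m) = m)
    (hPaths : ∀ γ ∈ Paths, IsPath IM k γ) (hinv : B.IsInvariant G Paths) (g : G)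
    {f : BoundedContinuousFunction (Connection B) ℂ} (hf : f ∈ Cyl B ν Paths) :
    pullback (phi IG hG g) f ∈ Cyl B ν Paths := by
  have h : StarAlgebra.adjoin ℂ (generators B ν Paths) ≤
      (StarAlgebra.adjoin ℂ (generators B ν Paths)).comap (pullback (phi IG hG g)) :=
    StarAlgebra.adjoin_le fun f hf => pullback_generator_mem hG hk hν hPaths hinv g hf
  exact map_mem_closure (continuous_pullback (phi IG hG g)) hf fun f hf => h hf

end CylAction
end GenConn

theorem mainTheorem5
    {EM HM M EP HP P ES HS S EG HG G : Type*}
    [NormedAddCommGroup EM] [NormedSpace ℝ EM] [FiniteDimensional ℝ EM] [TopologicalSpace HM]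
    (IM : ModelWithCorners ℝ EM HM) [IM.Boundaryless]
    [TopologicalSpace M] [T2Space M] [ChartedSpace HM M] [IsManifold IM ∞ M]
    [NormedAddCommGroup EP] [NormedSpace ℝ EP] [FiniteDimensional ℝ EP] [TopologicalSpace HP]
    (IP : ModelWithCorners ℝ EP HP) [IP.Boundaryless]
    [TopologicalSpace P] [T2Space P] [ChartedSpace HP P] [IsManifold IP ∞ P]
    -- the compact structure group
    [NormedAddCommGroup ES] [NormedSpace ℝ ES] [FiniteDimensional ℝ ES] [TopologicalSpace HS]
    (IS : ModelWithCorners ℝ ES HS) [IS.Boundaryless]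
    [TopologicalSpace S] [T2Space S] [ChartedSpace HS S] [Group S] [LieGroup IS ∞ S]
    [CompactSpace S]
    (B : GenConn.PrincipalBundle IM IP IS M P S)
    -- the Lie group of automorphisms
    [NormedAddCommGroup EG] [NormedSpace ℝ EG] [FiniteDimensional ℝ EG] [TopologicalSpace HG]
    (IG : ModelWithCorners ℝ EG HG) [IG.Boundaryless]
    [TopologicalSpace G] [ChartedSpace HG G] [Group G] [LieGroup IG ∞ G]
    [MulAction G P] [ContMDiffSMul IG IP ∞ G P] (hG : B.IsAutomorphismGroup G)
    -- a choice of a point in each fibre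
    (ν : M → P) (hν : ∀ m, B.proj (ν m) = m)
    -- the invariant set of `C^k`-paths (`M` is an analytic manifold if `k` is `ω`)
    (k : ℕ∞ω) (hk : 1 ≤ k) [IsManifold IM k M]
    (Paths : Set (GenConn.Curve M)) (hPaths : ∀ γ ∈ Paths, GenConn.IsPath IM k γ)
    (hinv : B.IsInvariant G Paths) :
    -- `φ_g^*` preserves the cylindrical functions, so that `Φ` is well defined
    ∃ h : ∀ g : G, ∀ f ∈ GenConn.Cyl B ν Paths,
        GenConn.pullback (GenConn.phi IG hG g) f ∈ GenConn.Cyl B ν Paths,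
      -- `Φ(g, χ) = χ ∘ φ_g^*` is the unique extended action
      GenConn.IsExtendedAction IG hG ν Paths (GenConn.specAction IG hG ν Paths h) ∧
      (∀ Ψ, GenConn.IsExtendedAction IG hG ν Paths Ψ →
        Ψ = GenConn.specAction IG hG ν Paths h) ∧
      -- the set of invariant generalized connections is compact
      IsCompact {χ | ∀ g : G, GenConn.specAction IG hG ν Paths h g χ = χ} ∧
      -- the commutative diagram and the homeomorphism
      (∀ η : GenConn.invariantConnections IG hG,
        GenConn.reducedMap IG hG ν Paths (GenConn.iota _ η) =
          GenConn.iota (GenConn.Cyl B ν Paths) η) ∧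
      IsEmbedding (GenConn.reducedMap IG hG ν Paths) ∧
      range (GenConn.reducedMap IG hG ν Paths) =
        closure (GenConn.iota (GenConn.Cyl B ν Paths) '' GenConn.invariantConnections IG hG) ∧
      closure (GenConn.iota (GenConn.Cyl B ν Paths) '' GenConn.invariantConnections IG hG) ⊆
        {χ | ∀ g : G, GenConn.specAction IG hG ν Paths h g χ = χ} ∧
      -- the characterization of continuity of `Φ`
      (Continuous (fun x : G × GenConn.GenConnection B ν Paths =>
          GenConn.specAction IG hG ν Paths h x.1 x.2) ↔
        ∀ f : GenConn.Cyl B ν Paths, f.1 ∈ GenConn.generators B ν Paths →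
          Continuous fun g : G =>
            (⟨GenConn.pullback (GenConn.phi IG hG g) f, h g f f.2⟩ : GenConn.Cyl B ν Paths)) := by
  have h : ∀ g : G, ∀ f ∈ GenConn.Cyl B ν Paths,
      GenConn.pullback (GenConn.phi IG hG g) f ∈ GenConn.Cyl B ν Paths := fun g f hf =>
    GenConn.pullback_mem_Cyl hG hk hν hPaths hinv g hf
  have : CompleteSpace ES := FiniteDimensional.complete ℝ ES
  refine ⟨h, GenConn.isExtendedAction_specAction hG h, fun Ψ hΨ => hΨ.eq_specAction hG h,
    (GenConn.isClosed_fixedPoints_specAction hG h).isCompact, fun η => rfl,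
    (GenConn.isClosedEmbedding_specMap_restrAlg _ _).isEmbedding, ?_,
    GenConn.closure_iota_invariantConnections_subset hG h, ?_⟩
  · refine (GenConn.range_specMap_restrAlg _ _).trans ?_
    rw [Subtype.range_coe]
  · refine (GenConn.continuous_specMap_iff _ _ h).trans ⟨fun hc f _ => hc f, fun hc f => ?_⟩
    refine Continuous.subtype_mk (GenConn.continuous_pullback_of_generators _ _ ?_ f.2) _
    intro f hf
    exact continuous_subtype_val.comp
      (hc ⟨f, StarSubalgebra.le_topologicalClosure _ (StarAlgebra.subset_adjoin ℂ _ hf)⟩ hf)
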